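/- **Proposition 3.11 (invariant $\overline{Q}_{\mathfrak{sl}_2}$ of biframed planar knotoids).** Let $k$ be a field with $2\neq 0$ in $k$, containing an element $\sqrt2$ and an invertible element $q^{1/4}$ with $q\neq 1$. Let $V$ be the 2-dimensional representation of $U_q(\mathfrak{sl}_2)$ over $k$ (generators $E,F,K^{\pm1}$ with $K=q^{H/2}$, $KE=qEK$, $FK=qKF$, $[E,F]=(K-K^{-1})/(q^{1/2}-q^{-1/2})$), with standard basis $e_1,e_2$, where $Ee_2=e_1$, $Fe_1=e_2$, $Ke_1=q^{1/2}e_1$, $Ke_2=q^{-1/2}e_2$. *Diagrams.* A planar multi-knotoid diagram consists of one oriented open strand, from its leg to its head, with vertical downward tangents at both end-points, and finitely many oriented closed strands, in Morse position in the plane; it is a knotoid diagram if there is no closed strand. Biframed planar (multi-)knotoids are these diagrams up to planar isotopy with fixed tangent directions at the end-points, the moves $R1'$ (a curl may change its side, but not the sign of its crossing), $R2$, $R3$ away from the end-points, and the coframing identities: inserting at the leg a crossingless full turn of the strand around the leg gives the same class as inserting at the head a crossingless full turn around the head whose tangent turns in the same direction. *The assignment.* Let $\varphi$ be the assignment that reads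 a diagram from top to bottom, with $V$ for downward and $V^*$ for upward strands, and sends positive and negative crossings to the braiding $\Psi^{\pm1}$ of $V$, $$\Psi(e_i\otimes e_i)=q^{1/4}e_i\otimes e_i,\quad \Psi(e_1\otimes e_2)=q^{-1/4}e_2\otimes e_1,\quad \Psi(e_2\otimes e_1)=q^{-1/4}e_1\otimes e_2+(q^{1/4}-q^{-3/4})e_2\otimes e_1,$$ maxima and minima to $1\mapsto\sum_i e_i\otimes e^i$, $f\otimes v\mapsto f(v)$, $1\mapsto\sum_i e^i\otimes K^{-1}e_i$, $v\otimes f\mapsto f(Kv)$, the leg to $\eta:1\mapsto\sum_i c_ie_i$ and the head to $\epsilon:e_i\mapsto d_i$, and is compatible with juxtaposition and composition. The maps assigned to crossings, maxima and minima are morphisms of $U_q(\mathfrak{sl}_2)$-modules. Take $c_1=c_2=d_1=d_2=1/\sqrt2$. Then $\varphi$ takes equal values on diagrams of the same biframed planar multi-knotoid, and so defines an invariant $\overline{Q}_{\mathfrak{sl}_2}$ of biframed planar multi-knotoids, in particular of biframed planar knotoids. It satisfies: 1. $q^{1/4}\,\overline{Q}(D_+)-q^{-1/4}\,\overline{Q}(D_-)=(q^{1/2}-q^{-1/2})\,\overline{Q}(D_0)$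 for diagrams that differ only at one place, where they have a positive crossing, a negative crossing, and its oriented smoothing; 2. inserting a curl with a positive (negative) crossing, on either side of a strand, multiplies $\overline{Q}$ by $q^{3/4}$ ($q^{-3/4}$); 3. inserting a link diagram $L$ disjoint from the rest, in a region of the diagram, multiplies $\overline{Q}$ by $\varphi(L)$; for a circle, of either orientation, the factor is $q^{1/2}+q^{-1/2}$; 4. inserting a coframing loop with counterclockwise (clockwise) turning tangent at the leg has the effect of replacing $(c_1,c_2)$ by $(q^{1/2}c_1,q^{-1/2}c_2)$ (by $(q^{-1/2}c_1,q^{1/2}c_2)$), and likewise at the head for $(d_1,d_2)$; 5. $\overline{Q}=1$ on the trivial knotoid, i.e. the straight arc. -/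

import Mathlib

open scoped TensorProduct

noncomputable section

namespace BiframedKnotoid

/-! ## The Hopf algebra `U_q(sl_2)` and its two-dimensional representation

The parameter is an invertible `t` with `t = q^{1/4}`, so `q = t ^ 4` and `q^{1/2} = t ^ 2`. -/

section Quantum

variable {k : Type*} [Field k]

/-- The four algebra generators of `U_q(sl_2)`; `K` stands for `q^{H/2}`. -/
inductive UqGen
  | E | F | K | Kinv

/-- The defining relations of `U_q(sl_2)`; the last one is
`[E, F] = (K - K⁻¹) / (q^{1/2} - q^{-1/2})`, with the denominator cleared. -/
inductive UqRel (t : kˣ) : FreeAlgebra k UqGen → FreeAlgebra k UqGen → Prop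
  | K_mul_Kinv : UqRel t (FreeAlgebra.ι k .K * FreeAlgebra.ι k .Kinv) 1
  | Kinv_mul_K : UqRel t (FreeAlgebra.ι k .Kinv * FreeAlgebra.ι k .K) 1
  | K_mul_E : UqRel t (FreeAlgebra.ι k .K * FreeAlgebra.ι k .E)
      ((t : k) ^ 4 • (FreeAlgebra.ι k .E * FreeAlgebra.ι k .K))
  | F_mul_K : UqRel t (FreeAlgebra.ι k .F * FreeAlgebra.ι k .K)
      ((t : k) ^ 4 • (FreeAlgebra.ι k .K * FreeAlgebra.ι k .F))
  | commutator : UqRel t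
      (((t : k) ^ 2 - ((t : k) ^ 2)⁻¹) •
        (FreeAlgebra.ι k .E * FreeAlgebra.ι k .F - FreeAlgebra.ι k .F * FreeAlgebra.ι k .E))
      (FreeAlgebra.ι k .K - FreeAlgebra.ι k .Kinv)

/-- The algebra `U_q(sl_2)` over `k`, with `q = t ^ 4`. -/
def Uq (t : kˣ) : Type _ := RingQuot (UqRel t)

instance (t : kˣ) : Semiring (Uq t) := inferInstanceAs (Semiring (RingQuot (UqRel t)))

instance (t : kˣ) : Algebra k (Uq t) := inferInstanceAs (Algebra k (RingQuot (UqRel t)))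

instance (t : kˣ) : Ring (Uq t) := Algebra.semiringToRing k

/-- The projection from the free algebra. -/
def Uq.mk (t : kˣ) : FreeAlgebra k UqGen →ₐ[k] Uq t := RingQuot.mkAlgHom k (UqRel t)

theorem Uq.mk_rel {t : kˣ} {x y : FreeAlgebra k UqGen} (h : UqRel t x y) :
    Uq.mk t x = Uq.mk t y := RingQuot.mkAlgHom_rel k h

/-- The universal property of `U_q(sl_2)`. -/
def Uq.lift (t : kˣ) {A : Type*} [Semiring A] [Algebra k A] (f : FreeAlgebra k UqGen →ₐ[k] A)
    (h : ∀ ⦃x y⦄, UqRel t x y → f x = f y) : Uq t →ₐ[k] A :=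
  RingQuot.liftAlgHom k ⟨f, h⟩

theorem Uq.lift_mk (t : kˣ) {A : Type*} [Semiring A] [Algebra k A] (f : FreeAlgebra k UqGen →ₐ[k] A)
    (h : ∀ ⦃x y⦄, UqRel t x y → f x = f y) (x : FreeAlgebra k UqGen) :
    Uq.lift t f h (Uq.mk t x) = f x :=
  RingQuot.liftAlgHom_mkAlgHom_apply k f h x

/-- The image of a generator in `U_q(sl_2)`. -/
def Uq.gen (t : kˣ) (x : UqGen) : Uq t := Uq.mk t (FreeAlgebra.ι k x)

theorem Uq.K_mul_Kinv (t : kˣ) : Uq.gen t .K * Uq.gen t .Kinv = 1 := by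
  simpa [Uq.gen] using Uq.mk_rel (UqRel.K_mul_Kinv (t := t))

theorem Uq.Kinv_mul_K (t : kˣ) : Uq.gen t .Kinv * Uq.gen t .K = 1 := by
  simpa [Uq.gen] using Uq.mk_rel (UqRel.Kinv_mul_K (t := t))

theorem Uq.K_mul_E (t : kˣ) :
    Uq.gen t .K * Uq.gen t .E = (t : k) ^ 4 • (Uq.gen t .E * Uq.gen t .K) := by
  simpa [Uq.gen] using Uq.mk_rel (UqRel.K_mul_E (t := t))

theorem Uq.F_mul_K (t : kˣ) :
    Uq.gen t .F * Uq.gen t .K = (t : k) ^ 4 • (Uq.gen t .K * Uq.gen t .F) := by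
  simpa [Uq.gen] using Uq.mk_rel (UqRel.F_mul_K (t := t))

theorem Uq.commutator (t : kˣ) :
    ((t : k) ^ 2 - ((t : k) ^ 2)⁻¹) •
      (Uq.gen t .E * Uq.gen t .F - Uq.gen t .F * Uq.gen t .E) =
      Uq.gen t .K - Uq.gen t .Kinv := by
  have h := Uq.mk_rel (UqRel.commutator (t := t))
  rw [map_smul, map_sub, map_sub, map_mul, map_mul] at h
  exact h

theorem Uq.E_mul_Kinv (t : kˣ) :
    Uq.gen t .E * Uq.gen t .Kinv = (t : k) ^ 4 • (Uq.gen t .Kinv * Uq.gen t .E) := by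
  have h := congrArg (fun z => Uq.gen t .Kinv * z * Uq.gen t .Kinv) (Uq.K_mul_E t)
  simpa [← mul_assoc, Uq.Kinv_mul_K, mul_assoc _ (Uq.gen t .K) (Uq.gen t .Kinv),
    Uq.K_mul_Kinv] using h

theorem Uq.Kinv_mul_F (t : kˣ) :
    Uq.gen t .Kinv * Uq.gen t .F = (t : k) ^ 4 • (Uq.gen t .F * Uq.gen t .Kinv) := by
  have h := congrArg (fun z => Uq.gen t .Kinv * z * Uq.gen t .Kinv) (Uq.F_mul_K t)
  simpa [← mul_assoc, Uq.Kinv_mul_K, mul_assoc _ (Uq.gen t .K) (Uq.gen t .Kinv),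
    Uq.K_mul_Kinv] using h

/-- The coproduct on generators: `Δ E = 1 ⊗ E + E ⊗ K`, `Δ F = K⁻¹ ⊗ F + F ⊗ 1`,
`Δ K = K ⊗ K`. -/
def Uq.comulGen (t : kˣ) : UqGen → Uq t ⊗[k] Uq t
  | .E => 1 ⊗ₜ Uq.gen t .E + Uq.gen t .E ⊗ₜ Uq.gen t .K
  | .F => Uq.gen t .Kinv ⊗ₜ Uq.gen t .F + Uq.gen t .F ⊗ₜ 1
  | .K => Uq.gen t .K ⊗ₜ Uq.gen t .K
  | .Kinv => Uq.gen t .Kinv ⊗ₜ Uq.gen t .Kinv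

/-- The coproduct of `U_q(sl_2)`. -/
def Uq.comul (t : kˣ) : Uq t →ₐ[k] Uq t ⊗[k] Uq t :=
  Uq.lift t (FreeAlgebra.lift k (Uq.comulGen t)) (by
    intro x y h
    cases h with
    | K_mul_Kinv => simp [Uq.comulGen, Uq.K_mul_Kinv, Algebra.TensorProduct.one_def]
    | Kinv_mul_K => simp [Uq.comulGen, Uq.Kinv_mul_K, Algebra.TensorProduct.one_def]
    | K_mul_E =>
      simp [Uq.comulGen, mul_add, add_mul, Uq.K_mul_E, TensorProduct.smul_tmul']
    | F_mul_K =>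
      simp [Uq.comulGen, mul_add, add_mul, Uq.F_mul_K, TensorProduct.smul_tmul', Uq.K_mul_Kinv,
        Uq.Kinv_mul_K]
    | commutator =>
      have h1 : (Uq.gen t .E * Uq.gen t .Kinv) ⊗ₜ[k] (Uq.gen t .K * Uq.gen t .F) =
          (Uq.gen t .Kinv * Uq.gen t .E) ⊗ₜ[k] (Uq.gen t .F * Uq.gen t .K) := by
        rw [Uq.E_mul_Kinv, Uq.F_mul_K, TensorProduct.smul_tmul]
      have h2 := congrArg (fun z => Uq.gen t .Kinv ⊗ₜ[k] z) (Uq.commutator t)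
      have h3 := congrArg (fun z => z ⊗ₜ[k] Uq.gen t .K) (Uq.commutator t)
      simp only [TensorProduct.tmul_smul, TensorProduct.tmul_sub] at h2
      simp only [← TensorProduct.smul_tmul', TensorProduct.sub_tmul] at h3
      simp only [map_smul, map_sub, map_mul, FreeAlgebra.lift_ι_apply, Uq.comulGen, mul_add,
        add_mul, Algebra.TensorProduct.tmul_mul_tmul, one_mul, mul_one, h1]
      have h4 := congrArg₂ (fun y z => y + z) h2 h3
      simp only [← smul_add] at h4
      convert h4 using 1
      · congr 1
        abel
      · abel)

/-- The counit on generators. -/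
def Uq.counitGen : UqGen → k
  | .E => 0
  | .F => 0
  | .K => 1
  | .Kinv => 1

/-- The counit of `U_q(sl_2)`. -/
def Uq.counit (t : kˣ) : Uq t →ₐ[k] k :=
  Uq.lift t (FreeAlgebra.lift k Uq.counitGen) (by
    intro x y h
    cases h <;> simp [Uq.counitGen])

/-- The antipode on generators: `S E = - E K⁻¹`, `S F = - K F`, `S K = K⁻¹`. -/
def Uq.antipodeGen (t : kˣ) : UqGen → (Uq t)ᵐᵒᵖ
  | .E => MulOpposite.op (-(Uq.gen t .E * Uq.gen t .Kinv))
  | .F => MulOpposite.op (-(Uq.gen t .K * Uq.gen t .F))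
  | .K => MulOpposite.op (Uq.gen t .Kinv)
  | .Kinv => MulOpposite.op (Uq.gen t .K)

/-- The antipode of `U_q(sl_2)`, as a homomorphism to the opposite algebra. -/
def Uq.antipode (t : kˣ) : Uq t →ₐ[k] (Uq t)ᵐᵒᵖ :=
  Uq.lift t (FreeAlgebra.lift k (Uq.antipodeGen t)) (by
    intro x y h
    cases h with
    | K_mul_Kinv => simp [Uq.antipodeGen, ← MulOpposite.op_mul, Uq.K_mul_Kinv]
    | Kinv_mul_K => simp [Uq.antipodeGen, ← MulOpposite.op_mul, Uq.Kinv_mul_K]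
    | K_mul_E =>
      simp only [map_smul, map_mul, FreeAlgebra.lift_ι_apply, Uq.antipodeGen,
        ← MulOpposite.op_mul, ← MulOpposite.op_smul]
      rw [neg_mul, mul_neg, smul_neg, ← mul_assoc, ← smul_mul_assoc, ← Uq.E_mul_Kinv]
    | F_mul_K =>
      simp only [map_smul, map_mul, FreeAlgebra.lift_ι_apply, Uq.antipodeGen,
        ← MulOpposite.op_mul, ← MulOpposite.op_smul]
      rw [mul_neg, neg_mul, smul_neg, ← smul_mul_assoc, ← Uq.F_mul_K, ← mul_assoc,
        Uq.Kinv_mul_K, mul_assoc, Uq.K_mul_Kinv, one_mul, mul_one]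
    | commutator =>
      simp only [map_smul, map_sub, map_mul, FreeAlgebra.lift_ι_apply, Uq.antipodeGen,
        ← MulOpposite.op_mul, ← MulOpposite.op_smul, ← MulOpposite.op_sub]
      have h1 : Uq.gen t .K * Uq.gen t .F * (Uq.gen t .E * Uq.gen t .Kinv) =
          Uq.gen t .F * Uq.gen t .E := by
        rw [Uq.E_mul_Kinv, mul_smul_comm, ← smul_mul_assoc, ← Uq.F_mul_K, mul_assoc,
          ← mul_assoc (Uq.gen t .K), Uq.K_mul_Kinv, one_mul]
      have h2 : Uq.gen t .E * Uq.gen t .Kinv * (Uq.gen t .K * Uq.gen t .F) =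
          Uq.gen t .E * Uq.gen t .F := by
        rw [mul_assoc, ← mul_assoc (Uq.gen t .Kinv), Uq.Kinv_mul_K, one_mul]
      rw [neg_mul_neg, neg_mul_neg, h1, h2, ← neg_sub (_ * _), smul_neg, Uq.commutator, neg_sub])

/-- The underlying space `V` of the two-dimensional representation; its standard basis vectors
are `e 0` and `e 1`. -/
abbrev V (k : Type*) : Type _ := Fin 2 → k

/-- The standard basis of `V`. -/
abbrev bV (k : Type*) [Field k] : Module.Basis (Fin 2) k (V k) := Pi.basisFun k (Fin 2)

/-- The basis of `V*` dual to the standard basis. -/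
abbrev bD (k : Type*) [Field k] : Module.Basis (Fin 2) k (Module.Dual k (V k)) :=
  (bV k).dualBasis

/-- The matrices of the generators on `V`. -/
def repMatrix (t : kˣ) : UqGen → Matrix (Fin 2) (Fin 2) k
  | .E => !![0, 1; 0, 0]
  | .F => !![0, 0; 1, 0]
  | .K => !![(t : k) ^ 2, 0; 0, ((t : k) ^ 2)⁻¹]
  | .Kinv => !![((t : k) ^ 2)⁻¹, 0; 0, (t : k) ^ 2]

/-- The standard two-dimensional representation of `U_q(sl_2)`. -/
def rep (t : kˣ) : Uq t →ₐ[k] Module.End k (V k) :=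
  (Matrix.toLinAlgEquiv' : Matrix (Fin 2) (Fin 2) k ≃ₐ[k] Module.End k (V k)).toAlgHom.comp
    (Uq.lift t (FreeAlgebra.lift k (repMatrix t)) (by
      intro x y h
      have ht : (t : k) ≠ 0 := t.ne_zero
      cases h <;> ext i j <;> fin_cases i <;> fin_cases j <;>
        simp [repMatrix, Matrix.mul_apply, Fin.sum_univ_two] <;> field_simp))

theorem rep_gen (t : kˣ) (x : UqGen) : rep t (Uq.gen t x) = Matrix.toLin' (repMatrix t x) := by
  simp only [rep, Uq.gen, AlgHom.comp_apply, Uq.lift_mk,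
    FreeAlgebra.lift_ι_apply]
  rfl

/-- The dual representation on `V*`: `(x • f) v = f (S x • v)`. -/
def dualRep (t : kˣ) : Uq t →ₐ[k] Module.End k (Module.Dual k (V k)) :=
  AlgHom.ofLinearMap
    (Module.Dual.transpose (R := k) (M := V k) (M' := V k) ∘ₗ (rep t).toLinearMap ∘ₗ
      (MulOpposite.opLinearEquiv k).symm.toLinearMap ∘ₗ (Uq.antipode t).toLinearMap)
    (by ext; simp [Module.Dual.transpose_apply])
    (by intro x y; ext; simp [Module.Dual.transpose_apply])

/-- The tensor product of two representations, through the coproduct. -/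
def tensorRep (t : kˣ) {M N : Type*} [AddCommGroup M] [Module k M] [AddCommGroup N] [Module k N]
    (ρ : Uq t →ₐ[k] Module.End k M) (σ : Uq t →ₐ[k] Module.End k N) :
    Uq t →ₐ[k] Module.End k (M ⊗[k] N) :=
  (Module.endTensorEndAlgHom (R := k) (S := k) (A := k) (M := M) (N := N)).comp
    ((Algebra.TensorProduct.map ρ σ).comp (Uq.comul t))

/-- The trivial representation on `k`, through the counit. -/
def trivialRep (t : kˣ) : Uq t →ₐ[k] Module.End k k :=
  (Algebra.lmul k k).comp (Uq.counit t)

/-- A linear map is a morphism of `U_q(sl_2)`-modules. -/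
def IsIntertwiner {t : kˣ} {M N : Type*} [AddCommGroup M] [Module k M] [AddCommGroup N]
    [Module k N] (ρ : Uq t →ₐ[k] Module.End k M) (σ : Uq t →ₐ[k] Module.End k N)
    (f : M →ₗ[k] N) : Prop :=
  ∀ x : Uq t, f ∘ₗ ρ x = σ x ∘ₗ f

/-- The operator `q^{(H ⊗ H)/4}` on `V ⊗ V`, where `H e_0 = e_0` and `H e_1 = - e_1`. -/
def qHH (t : kˣ) : V k ⊗[k] V k →ₗ[k] V k ⊗[k] V k :=
  ((bV k).tensorProduct (bV k)).constr k fun p =>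
    ((if p.1 = p.2 then t else t⁻¹ : kˣ) : k) • (bV k p.1 ⊗ₜ[k] bV k p.2)

/-- The nilpotent operator `(q^{1/2} - q^{-1/2}) E ⊗ F` on `V ⊗ V`. -/
def nilEF (t : kˣ) : V k ⊗[k] V k →ₗ[k] V k ⊗[k] V k :=
  ((t : k) ^ 2 - ((t : k) ^ 2)⁻¹) • TensorProduct.map (rep t (Uq.gen t .E)) (rep t (Uq.gen t .F))

theorem qHH_tmul (t : kˣ) (i j : Fin 2) : qHH t (bV k i ⊗ₜ[k] bV k j) =
    ((if i = j then t else t⁻¹ : kˣ) : k) • (bV k i ⊗ₜ[k] bV k j) := by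
  have h := ((bV k).tensorProduct (bV k)).constr_basis k (fun p : Fin 2 × Fin 2 =>
    ((if p.1 = p.2 then t else t⁻¹ : kˣ) : k) • (bV k p.1 ⊗ₜ[k] bV k p.2)) (i, j)
  rwa [Module.Basis.tensorProduct_apply] at h

theorem nilEF_tmul (t : kˣ) (i j : Fin 2) : nilEF t (bV k i ⊗ₜ[k] bV k j) =
    if i = 1 ∧ j = 0 then ((t : k) ^ 2 - ((t : k) ^ 2)⁻¹) • (bV k 0 ⊗ₜ[k] bV k 1) else 0 := by
  have hE : ∀ i, Matrix.toLin' (repMatrix t .E) (bV k i) = if i = 1 then bV k 0 else 0 := by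
    intro i
    ext m
    fin_cases i <;> fin_cases m <;> simp [repMatrix]
  have hF : ∀ i, Matrix.toLin' (repMatrix t .F) (bV k i) = if i = 0 then bV k 1 else 0 := by
    intro i
    ext m
    fin_cases i <;> fin_cases m <;> simp [repMatrix]
  simp only [nilEF, LinearMap.smul_apply, TensorProduct.map_tmul, rep_gen, hE, hF]
  fin_cases i <;> fin_cases j <;> simp

theorem qHH_qHH_inv (t : kˣ) (z : V k ⊗[k] V k) : qHH t (qHH t⁻¹ z) = z := by
  have h : qHH t ∘ₗ qHH t⁻¹ = LinearMap.id := by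
    refine ((bV k).tensorProduct (bV k)).ext ?_
    rintro ⟨i, j⟩
    by_cases hij : i = j <;>
      simp only [LinearMap.comp_apply, Module.Basis.tensorProduct_apply, qHH_tmul, map_smul,
        smul_smul, hij, if_true, if_false, LinearMap.id_apply, inv_inv, Units.inv_mul,
        Units.mul_inv, one_smul]
  exact LinearMap.congr_fun h z

theorem nilEF_nilEF (t : kˣ) (z : V k ⊗[k] V k) : nilEF t (nilEF t z) = 0 := by
  have h : nilEF t ∘ₗ nilEF t = 0 := by
    refine ((bV k).tensorProduct (bV k)).ext ?_
    rintro ⟨i, j⟩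
    rw [LinearMap.comp_apply, Module.Basis.tensorProduct_apply, nilEF_tmul]
    split_ifs
    · rw [map_smul, nilEF_tmul, if_neg (by simp), smul_zero, LinearMap.zero_apply]
    · rw [map_zero, LinearMap.zero_apply]
  exact LinearMap.congr_fun h z

/-- The braiding `Ψ` of `V` with itself: the flip composed with the action of the universal
`R`-matrix `q^{(H ⊗ H)/4} ∑ₙ aₙ Eⁿ ⊗ Fⁿ` on `V ⊗ V`, where only `n = 0, 1` contribute as `E² = 0`
on `V`. -/
def braiding (t : kˣ) : (V k ⊗[k] V k) ≃ₗ[k] (V k ⊗[k] V k) :=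
  LinearEquiv.ofLinearMap
    ((TensorProduct.comm k (V k) (V k)).toLinearMap ∘ₗ qHH t ∘ₗ (LinearMap.id + nilEF t))
    ((LinearMap.id - nilEF t) ∘ₗ qHH t⁻¹ ∘ₗ (TensorProduct.comm k (V k) (V k)).toLinearMap)
    (by
      refine LinearMap.ext fun z => ?_
      have h : ∀ w : V k ⊗[k] V k, w - nilEF t w + nilEF t (w - nilEF t w) = w := by
        intro w
        rw [map_sub, nilEF_nilEF]
        abel
      simp only [LinearMap.comp_apply, LinearMap.add_apply, LinearMap.sub_apply,
        LinearMap.id_apply, LinearEquiv.coe_coe, h, qHH_qHH_inv]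
      simp)
    (by
      refine LinearMap.ext fun z => ?_
      have h := qHH_qHH_inv t⁻¹
      rw [inv_inv] at h
      have hc : ∀ w : V k ⊗[k] V k,
          TensorProduct.comm k (V k) (V k) (TensorProduct.comm k (V k) (V k) w) = w := by
        simp
      simp only [LinearMap.comp_apply, LinearMap.add_apply, LinearMap.sub_apply,
        LinearMap.id_apply, LinearEquiv.coe_coe, hc, h, map_add, nilEF_nilEF]
      abel)

/-- Evaluation `V* ⊗ V → k`, `f ⊗ v ↦ f v`. -/
def ev (k : Type*) [Field k] : Module.Dual k (V k) ⊗[k] V k →ₗ[k] k := contractLeft k (V k)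

/-- Coevaluation `k → V ⊗ V*`, `1 ↦ ∑ e_i ⊗ e^i`. -/
def coev (k : Type*) [Field k] : k →ₗ[k] V k ⊗[k] Module.Dual k (V k) := coevaluation k (V k)

/-- The second evaluation `V ⊗ V* → k`, `v ⊗ f ↦ f (K v)`; here `K = u ν⁻¹` is the group-like
element attached to the ribbon element `ν`. -/
def evBar (t : kˣ) : V k ⊗[k] Module.Dual k (V k) →ₗ[k] k :=
  ev k ∘ₗ (TensorProduct.comm k (V k) (Module.Dual k (V k))).toLinearMap ∘ₗ
    TensorProduct.map (rep t (Uq.gen t .K)) LinearMap.id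

/-- The second coevaluation `k → V* ⊗ V`, `1 ↦ ∑ e^i ⊗ K⁻¹ e_i`. -/
def coevBar (t : kˣ) : k →ₗ[k] Module.Dual k (V k) ⊗[k] V k :=
  TensorProduct.map LinearMap.id (rep t (Uq.gen t .Kinv)) ∘ₗ
    (TensorProduct.comm k (V k) (Module.Dual k (V k))).toLinearMap ∘ₗ coev k

/-- The linear map `η : k → V`, `1 ↦ ∑ c_i e_i`, placed at the leg. -/
def legMap (c : Fin 2 → k) : k →ₗ[k] V k := LinearMap.toSpanSingleton k (V k) (∑ i, c i • bV k i)

/-- The linear map `ε : V → k`, `∑ λ_i e_i ↦ ∑ λ_i d_i`, placed at the head. -/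
def headMap (d : Fin 2 → k) : V k →ₗ[k] k := (bV k).constr k d

end Quantum

/-! ## Diagrams in the plane, cut into horizontal layers -/

/-- The direction of a strand; diagrams are read from top to bottom. -/
inductive Dir
  | down | up
  deriving DecidableEq

/-- The elementary pieces of an oriented diagram: crossings of two downward strands, with their
sign; the four oriented maxima and minima; the leg, out of which a strand runs downwards; the
head, into which a strand runs downwards. Crossings of strands with other directions are obtained
by rotating these with maxima and minima. -/
inductive Piece
  | pos | neg
  | capDU | capUD
  | cupUD | cupDU
  | leg | head
  deriving DecidableEq

/-- The directions of the strands that enter a piece from above, from left to right. -/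
def Piece.dom : Piece → List Dir
  | .pos | .neg => [.down, .down]
  | .capDU | .capUD | .leg => []
  | .cupUD => [.up, .down]
  | .cupDU => [.down, .up]
  | .head => [.down]

/-- The directions of the strands that leave a piece below, from left to right. -/
def Piece.cod : Piece → List Dir
  | .pos | .neg => [.down, .down]
  | .cupUD | .cupDU | .head => []
  | .capDU => [.down, .up]
  | .capUD => [.up, .down]
  | .leg => [.down]

/-- A horizontal layer `(n, g)`: `n` vertical strands, then the piece `g`, then further vertical
strands (as many as there are left). -/
abbrev Layer : Type := ℕ × Piece

/-- The layer fits below a row of strands with directions `w`. -/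
def Fits (w : List Dir) (x : Layer) : Prop := x.1 ≤ w.length ∧ x.2.dom <+: w.drop x.1

/-- The row of strands below a layer. -/
def below (w : List Dir) (x : Layer) : List Dir :=
  w.take x.1 ++ x.2.cod ++ w.drop (x.1 + x.2.dom.length)

/-- The row of strands below a stack of layers, listed from top to bottom. -/
def target (w : List Dir) (L : List Layer) : List Dir := L.foldl below w

/-- Each layer of the stack fits below the previous ones. -/
def Composable : List Dir → List Layer → Prop
  | _, [] => True
  | w, x :: L => Fits w x ∧ Composable (below w x) L

/-- The stack of layers is a diagram without in- or outgoing strands. -/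
def IsClosedStack (L : List Layer) : Prop := Composable [] L ∧ target [] L = []

/-- The number of occurrences of a piece. -/
def numPieces (g : Piece) (L : List Layer) : ℕ := L.countP (fun x => decide (x.2 = g))

/-- A diagram in the plane of an oriented link. -/
def IsLink (L : List Layer) : Prop := IsClosedStack L ∧ numPieces .leg L = 0 ∧ numPieces .head L = 0

/-- A diagram in the plane consisting of one open strand, from its leg to its head, and any number
of closed strands. The tangents at the leg and at the head point vertically downwards. -/
structure MultiDiagram where
  layers : List Layer
  isClosed : IsClosedStack layers
  one_leg : numPieces .leg layers = 1
  one_head : numPieces .head layers = 1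

/-- Two points of the strands, in neighbouring rows or in the same row, are joined by a layer. The
point `(i, p)` is the point number `p` in the row below the first `i` layers. -/
inductive Joined (L : List Layer) : ℕ × ℕ → ℕ × ℕ → Prop
  | left (i n : ℕ) (g : Piece) (p : ℕ) (h : L[i]? = some (n, g)) (hp : p < n) :
      Joined L (i, p) (i + 1, p)
  | right (i n : ℕ) (g : Piece) (p : ℕ) (h : L[i]? = some (n, g)) :
      Joined L (i, n + g.dom.length + p) (i + 1, n + g.cod.length + p)
  | cross_right (i n : ℕ) (g : Piece) (h : L[i]? = some (n, g)) (hg : g = .pos ∨ g = .neg) :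
      Joined L (i, n) (i + 1, n + 1)
  | cross_left (i n : ℕ) (g : Piece) (h : L[i]? = some (n, g)) (hg : g = .pos ∨ g = .neg) :
      Joined L (i, n + 1) (i + 1, n)
  | cap (i n : ℕ) (g : Piece) (h : L[i]? = some (n, g)) (hg : g = .capDU ∨ g = .capUD) :
      Joined L (i + 1, n) (i + 1, n + 1)
  | cup (i n : ℕ) (g : Piece) (h : L[i]? = some (n, g)) (hg : g = .cupDU ∨ g = .cupUD) :
      Joined L (i, n) (i, n + 1)

/-- `(i, p)` is a point of a strand of the diagram. -/
def IsPoint (L : List Layer) (x : ℕ × ℕ) : Prop :=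
  x.1 ≤ L.length ∧ x.2 < (target [] (L.take x.1)).length

/-- The diagram is a knotoid diagram: it has a single strand, so no closed ones. -/
def MultiDiagram.IsKnotoid (D : MultiDiagram) : Prop :=
  ∀ x y, IsPoint D.layers x → IsPoint D.layers y → Relation.EqvGen (Joined D.layers) x y

/-! ## The moves -/

/-- Put `n` vertical strands to the left of all layers. -/
def shift (n : ℕ) (L : List Layer) : List Layer := L.map fun x => (n + x.1, x.2)

/-- A crossing of the given sign. -/
def crossing (s : Bool) : Piece := if s then .pos else .neg

/-- A crossing turned by a quarter, as a piece from `↑↓` to `↓↑`. -/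
def sideUD (g : Piece) : List Layer := [(2, .capDU), (1, g), (0, .cupUD)]

/-- A crossing turned by a quarter, as a piece from `↓↑` to `↑↓`. -/
def sideDU (g : Piece) : List Layer := [(0, .capUD), (1, g), (2, .cupDU)]

/-- A curl with one crossing in a downward strand, to the right of the strand. -/
def kinkRight (g : Piece) : List Layer := [(1, .capDU), (0, g), (1, .cupDU)]

/-- A curl with one crossing in a downward strand, to the left of the strand. -/
def kinkLeft (g : Piece) : List Layer := [(0, .capUD), (1, g), (0, .cupUD)]

/-- The local moves: planar isotopies (`interchange`, `zigzag`, `rotate`), and the moves `R1'`,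
`R2` and `R3`. In `R1'` a curl may change its side but not the sign of its crossing. No move takes a
strand over or under an end-point. -/
inductive LocalMove : List Layer → List Layer → Prop
  | interchange (i j : ℕ) (g h : Piece) :
      LocalMove [(i, g), (i + g.cod.length + j, h)] [(i + g.dom.length + j, h), (i, g)]
  | zigzag_down : LocalMove [(0, .capDU), (1, .cupUD)] []
  | zigzag_down' : LocalMove [(1, .capUD), (0, .cupDU)] []
  | zigzag_up : LocalMove [(1, .capDU), (0, .cupUD)] []
  | zigzag_up' : LocalMove [(0, .capUD), (1, .cupDU)] []
  | rotate (s : Bool) : LocalMove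
      [(2, .capDU), (3, .capDU), (2, crossing s), (1, .cupUD), (0, .cupUD)]
      [(0, .capUD), (1, .capUD), (2, crossing s), (3, .cupDU), (2, .cupDU)]
  | r1' (s : Bool) : LocalMove (kinkRight (crossing s)) (kinkLeft (crossing s))
  | r2 (s : Bool) : LocalMove [(0, crossing s), (0, crossing !s)] []
  | r2_anti (s : Bool) : LocalMove (sideUD (crossing s) ++ sideDU (crossing !s)) []
  | r2_anti' (s : Bool) : LocalMove (sideDU (crossing s) ++ sideUD (crossing !s)) []
  | r3 : LocalMove [(0, .pos), (1, .pos), (0, .pos)] [(1, .pos), (0, .pos), (1, .pos)]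

/-- A full turn of the strand around the leg, without crossings. The tangent of the strand turns
by `2π`, counterclockwise if `s` is `true` and clockwise otherwise. -/
def legLoop (s : Bool) (n : ℕ) : List Layer :=
  if s then [(n, .capDU), (n + 1, .leg), (n + 1, .cupDU)]
  else [(n, .capUD), (n + 1, .leg), (n, .cupUD)]

/-- A full turn of the strand around the head, without crossings. The tangent of the strand turns
by `2π`, counterclockwise if `s` is `true` and clockwise otherwise. -/
def headLoop (s : Bool) (n : ℕ) : List Layer :=
  if s then [(n + 1, .capDU), (n + 1, .head), (n, .cupDU)]
  else [(n, .capUD), (n + 1, .head), (n, .cupUD)]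

/-- Insert a coframing loop at the leg. -/
def addLegLoop (s : Bool) (L : List Layer) : List Layer :=
  L.flatMap fun x => if x.2 = .leg then legLoop s x.1 else [x]

/-- Insert a coframing loop at the head. -/
def addHeadLoop (s : Bool) (L : List Layer) : List Layer :=
  L.flatMap fun x => if x.2 = .head then headLoop s x.1 else [x]

/-- The moves on biframed planar diagrams: a local move somewhere in the diagram, or a coframing
identity, which trades a coframing loop at the leg for the coframing loop at the head in which
the tangent turns in the same direction. -/
inductive Move : MultiDiagram → MultiDiagram → Prop
  | loc {D D' : MultiDiagram} (pre post : List Layer) (n : ℕ) (u v : List Layer)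
      (h : LocalMove u v) (hD : D.layers = pre ++ shift n u ++ post)
      (hD' : D'.layers = pre ++ shift n v ++ post) : Move D D'
  | coframing {D D' : MultiDiagram} (s : Bool) (D₀ : MultiDiagram)
      (hD : D.layers = addLegLoop s D₀.layers)
      (hD' : D'.layers = addHeadLoop s D₀.layers) : Move D D'

/-- Biframed planar multi-knotoids: diagrams of one open and any number of closed strands, up to
the equivalence relation generated by the moves. -/
def BiframedPlanarMultiknotoid : Type := Quot Move

/-- Biframed planar knotoids: knotoid diagrams up to the equivalence relation generated by the
moves. -/
def BiframedPlanarKnotoid : Type :=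
  Quot fun D D' : {D : MultiDiagram // D.IsKnotoid} => Move D.1 D'.1

/-- The class of a diagram. -/
def MultiDiagram.toClass (D : MultiDiagram) : BiframedPlanarMultiknotoid := Quot.mk _ D

/-- A biframed planar knotoid as a multi-knotoid without closed strands. -/
def BiframedPlanarKnotoid.toMulti : BiframedPlanarKnotoid → BiframedPlanarMultiknotoid :=
  Quot.map Subtype.val fun _ _ h => h

/-- The straight arc. -/
def trivialDiagram : MultiDiagram where
  layers := [(0, .leg), (0, .head)]
  isClosed := by simp [IsClosedStack, Composable, Fits, below, target, Piece.dom, Piece.cod]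
  one_leg := by decide
  one_head := by decide

theorem trivialDiagram_isKnotoid : trivialDiagram.IsKnotoid := by
  have key : ∀ z, IsPoint trivialDiagram.layers z → z = (1, 0) := by
    rintro ⟨i, p⟩ ⟨h1, h2⟩
    simp only [trivialDiagram, List.length_cons, List.length_nil] at h1 h2
    interval_cases i <;> simp [target, below, Piece.dom, Piece.cod] at h2 ⊢
    exact h2
  intro x y hx hy
  rw [key x hx, key y hy]
  exact Relation.EqvGen.refl _

/-- The trivial biframed planar knotoid. -/
def trivialKnotoid : BiframedPlanarKnotoid := Quot.mk _ ⟨trivialDiagram, trivialDiagram_isKnotoid⟩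

/-! ## The assignment `φ` -/

section Phi

variable {k : Type*} [Field k]

/-- The matrix entries of the linear map that `φ` assigns to a piece, with respect to the standard
basis of `V` (downward strands), the dual basis of `V*` (upward strands), and their tensor products:
the first list indexes the basis of the source, the second one that of the target. -/
def entry (t : kˣ) (c d : Fin 2 → k) : Piece → List (Fin 2) → List (Fin 2) → k
  | .pos, [i, j], [l, m] =>
      ((bV k).tensorProduct (bV k)).repr (braiding t (bV k i ⊗ₜ[k] bV k j)) (l, m)
  | .neg, [i, j], [l, m] =>
      ((bV k).tensorProduct (bV k)).repr ((braiding t).symm (bV k i ⊗ₜ[k] bV k j)) (l, m)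
  | .capDU, [], [l, m] => ((bV k).tensorProduct (bD k)).repr (coev k 1) (l, m)
  | .capUD, [], [l, m] => ((bD k).tensorProduct (bV k)).repr (coevBar t 1) (l, m)
  | .cupUD, [i, j], [] => ev k (bD k i ⊗ₜ[k] bV k j)
  | .cupDU, [i, j], [] => evBar t (bV k i ⊗ₜ[k] bD k j)
  | .leg, [], [l] => (bV k).repr (legMap c 1) l
  | .head, [i], [] => headMap d (bV k i)
  | _, _, _ => 0

/-- The direct sum of all tensor powers of `V` and `V*`: the list `[i₁, …, iₘ]` stands for the basis
vector with indices `i₁, …, iₘ` in the tensor product attached to a row of `m` strands. -/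
abbrev States (k : Type*) [Field k] : Type _ := List (Fin 2) →₀ k

/-- The value of the linear map `φ(g)` of a piece on a basis vector. -/
def pieceMap (t : kˣ) (c d : Fin 2 → k) (g : Piece) (s : List (Fin 2)) : States k :=
  ∑ u : Fin g.cod.length → Fin 2, Finsupp.single (List.ofFn u) (entry t c d g s (List.ofFn u))

/-- The linear map `id ⊗ φ(g) ⊗ id` of a layer `(n, g)`. -/
def layerMap (t : kˣ) (c d : Fin 2 → k) (x : Layer) : States k →ₗ[k] States k :=
  Finsupp.linearCombination k fun s =>
    (pieceMap t c d x.2 ((s.drop x.1).take x.2.dom.length)).mapDomain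
      fun u => s.take x.1 ++ u ++ s.drop (x.1 + x.2.dom.length)

/-- The linear map of a stack of layers: the composition of the maps of its layers. -/
def stackMap (t : kˣ) (c d : Fin 2 → k) (L : List Layer) : States k →ₗ[k] States k :=
  L.foldl (fun f x => layerMap t c d x ∘ₗ f) LinearMap.id

/-- The value `φ(D)`, a linear map `k → k`, that is, a scalar, for a diagram without in- or
outgoing strands. -/
def phi (t : kˣ) (c d : Fin 2 → k) (L : List Layer) : k :=
  stackMap t c d L (Finsupp.single [] 1) []

end Phi

end BiframedKnotoid

end

open scoped TensorProduct

noncomputable section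

namespace BiframedKnotoid

/-! ### Morphisms of `U_q(sl_2)`-modules: crossings, maxima and minima on basis vectors. -/

section Intertwiners

variable {k : Type*} [Field k]

/-! The value `phi` is a state sum over colourings of the strands by the two basis vectors, and
invariance follows from two facts.

The first is locality. A layer changes only the colours at its piece (`layerMap_single`), so a stack
placed between further strands acts as its own map with identities on both sides
(`stackMap_shift_pad`, `stackMap_shift_congr`). Every local move except the interchange of distant
layers thus becomes an identity of linear maps on one, two or three strands. These are the zigzag
identities, the quadratic and braid relations of the braiding and their duals, and they are checked
on each colouring. The interchange is the commutation of operators on disjoint tensor factors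
(`layerMap_interchange`). Locality also gives the skein relation, the factor of a curl
(`stackMap_kinkRight`, `stackMap_kinkLeft`) and that of a separate link: whatever is scalar where it
is inserted multiplies the value (`phi_eq_smul`).

The second is a torus symmetry. The braiding preserves the multiset of colours, and maxima and
minima pair a colour with its dual. An arbitrary diagonal matrix, acting on downward strands and by
its inverse on upward ones, therefore commutes with every piece except the leg and the head
(`entry_weight`), and can be carried from the leg to the head of a closed stack (`phi_gauge`). A
coframing loop acts by the diagonal matrix `K` or `K⁻¹` at its end-point, with the same power at the
leg and at the head if the tangents turn alike (`stackMap_legLoop`, `stackMap_headLoop`). This is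
the coframing identity.

The special coefficients `1 / r` enter only in the value of the straight arc. The module morphism
property is checked on generators and basis vectors, and the invariance does not rest on it. -/

theorem Uq.mk_surjective (t : kˣ) : Function.Surjective (Uq.mk t) :=
  RingQuot.mkAlgHom_surjective k (UqRel t)

/-- It suffices to check the intertwining property on generators. -/
theorem IsIntertwiner.of_gen {t : kˣ} {M N : Type*} [AddCommGroup M] [Module k M] [AddCommGroup N]
    [Module k N] {ρ : Uq t →ₐ[k] Module.End k M} {σ : Uq t →ₐ[k] Module.End k N}
    {f : M →ₗ[k] N} (h : ∀ x v, f (ρ (Uq.gen t x) v) = σ (Uq.gen t x) (f v)) :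
    IsIntertwiner ρ σ f := by
  intro x
  obtain ⟨y, rfl⟩ := Uq.mk_surjective t x
  refine LinearMap.ext fun v => ?_
  simp only [LinearMap.comp_apply]
  induction y using FreeAlgebra.induction generalizing v with
  | grade0 r => simp [AlgHom.commutes, Module.algebraMap_end_apply]
  | grade1 x => exact h x v
  | mul a b ha hb => simp only [map_mul, Module.End.mul_apply, ha, hb]
  | add a b ha hb => simp only [map_add, LinearMap.add_apply, ha, hb]

theorem IsIntertwiner.symm {t : kˣ} {M N : Type*} [AddCommGroup M] [Module k M] [AddCommGroup N]
    [Module k N] {ρ : Uq t →ₐ[k] Module.End k M} {σ : Uq t →ₐ[k] Module.End k N}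
    {f : M ≃ₗ[k] N} (h : IsIntertwiner ρ σ f.toLinearMap) :
    IsIntertwiner σ ρ f.symm.toLinearMap := by
  intro x
  refine LinearMap.ext fun v => f.injective ?_
  have := LinearMap.congr_fun (h x) (f.symm v)
  simp only [LinearMap.comp_apply, LinearEquiv.coe_coe, LinearEquiv.apply_symm_apply] at this ⊢
  exact this.symm

theorem Uq.comul_gen (t : kˣ) (x : UqGen) : Uq.comul t (Uq.gen t x) = Uq.comulGen t x := by
  simp [Uq.comul, Uq.gen, Uq.lift_mk]

theorem Uq.counit_gen (t : kˣ) (x : UqGen) : Uq.counit t (Uq.gen t x) = Uq.counitGen x := by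
  simp [Uq.counit, Uq.gen, Uq.lift_mk]

theorem Uq.antipode_gen (t : kˣ) (x : UqGen) :
    Uq.antipode t (Uq.gen t x) = Uq.antipodeGen t x := by
  simp [Uq.antipode, Uq.gen, Uq.lift_mk]

section Tensor

variable {t : kˣ} {M N : Type*} [AddCommGroup M] [Module k M] [AddCommGroup N] [Module k N]
  (ρ : Uq t →ₐ[k] Module.End k M) (σ : Uq t →ₐ[k] Module.End k N) (m : M) (n : N)

theorem tensorRep_E : tensorRep t ρ σ (Uq.gen t .E) (m ⊗ₜ n) =
    m ⊗ₜ σ (Uq.gen t .E) n + ρ (Uq.gen t .E) m ⊗ₜ σ (Uq.gen t .K) n := by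
  simp [tensorRep, Uq.comul_gen, Uq.comulGen, Module.endTensorEndAlgHom_apply]

theorem tensorRep_F : tensorRep t ρ σ (Uq.gen t .F) (m ⊗ₜ n) =
    ρ (Uq.gen t .Kinv) m ⊗ₜ σ (Uq.gen t .F) n + ρ (Uq.gen t .F) m ⊗ₜ n := by
  simp [tensorRep, Uq.comul_gen, Uq.comulGen, Module.endTensorEndAlgHom_apply]

theorem tensorRep_K : tensorRep t ρ σ (Uq.gen t .K) (m ⊗ₜ n) =
    ρ (Uq.gen t .K) m ⊗ₜ σ (Uq.gen t .K) n := by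
  simp [tensorRep, Uq.comul_gen, Uq.comulGen, Module.endTensorEndAlgHom_apply]

theorem tensorRep_Kinv : tensorRep t ρ σ (Uq.gen t .Kinv) (m ⊗ₜ n) =
    ρ (Uq.gen t .Kinv) m ⊗ₜ σ (Uq.gen t .Kinv) n := by
  simp [tensorRep, Uq.comul_gen, Uq.comulGen, Module.endTensorEndAlgHom_apply]

end Tensor

theorem trivialRep_gen (t : kˣ) (x : UqGen) (a : k) :
    trivialRep t (Uq.gen t x) a = Uq.counitGen x * a := by
  simp [trivialRep, Uq.counit_gen]

theorem dualRep_apply (t : kˣ) (x : Uq t) (f : Module.Dual k (V k)) (v : V k) :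
    dualRep t x f v = f (rep t (MulOpposite.unop (Uq.antipode t x)) v) := rfl

theorem rep_gen_basis (t : kˣ) (x : UqGen) (i : Fin 2) :
    rep t (Uq.gen t x) (bV k i) =
      repMatrix t x 0 i • bV k 0 + repMatrix t x 1 i • bV k 1 := by
  rw [rep_gen]
  ext m
  fin_cases i <;> fin_cases m <;> simp

theorem bD_bV (i j : Fin 2) : bD k i (bV k j) = if j = i then 1 else 0 := by
  rw [Module.Basis.dualBasis_apply_self]

/-- The matrices of the generators on `V*`, with respect to the dual basis. -/
def dualRepMatrix (t : kˣ) : UqGen → Matrix (Fin 2) (Fin 2) k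
  | .E => !![0, 0; -(t : k) ^ 2, 0]
  | .F => !![0, -((t : k) ^ 2)⁻¹; 0, 0]
  | .K => !![((t : k) ^ 2)⁻¹, 0; 0, (t : k) ^ 2]
  | .Kinv => !![(t : k) ^ 2, 0; 0, ((t : k) ^ 2)⁻¹]

theorem dualRep_gen_basis (t : kˣ) (x : UqGen) (i : Fin 2) :
    dualRep t (Uq.gen t x) (bD k i) =
      dualRepMatrix t x 0 i • bD k 0 + dualRepMatrix t x 1 i • bD k 1 := by
  refine (bV k).ext fun j => ?_
  rw [dualRep_apply, Uq.antipode_gen]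
  cases x <;>
  simp only [Uq.antipodeGen, MulOpposite.unop_op, map_neg, map_mul, LinearMap.neg_apply,
    Module.End.mul_apply, rep_gen_basis, map_add, map_smul, LinearMap.add_apply,
    LinearMap.smul_apply, bD_bV] <;>
  fin_cases i <;> fin_cases j <;> simp [repMatrix, dualRepMatrix]

/-- The universal `R`-matrix yields the explicit braiding. The coefficient `t - t⁻³` is the product
of `t² - t⁻²` from the nilpotent part and `t⁻¹` from `qHH`. -/
theorem braiding_tmul (t : kˣ) (i j : Fin 2) : braiding t (bV k i ⊗ₜ[k] bV k j) =
    if i = j then (t : k) • (bV k i ⊗ₜ[k] bV k j)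
    else if i = 0 then (t : k)⁻¹ • (bV k 1 ⊗ₜ[k] bV k 0)
    else (t : k)⁻¹ • (bV k 0 ⊗ₜ[k] bV k 1) +
      ((t : k) - ((t : k) ^ 3)⁻¹) • (bV k 1 ⊗ₜ[k] bV k 0) := by
  have ht : (t : k) ≠ 0 := t.ne_zero
  have h : braiding t (bV k i ⊗ₜ[k] bV k j) = TensorProduct.comm k (V k) (V k)
      (qHH t (bV k i ⊗ₜ[k] bV k j + nilEF t (bV k i ⊗ₜ[k] bV k j))) := rfl
  rw [h, nilEF_tmul]
  fin_cases i <;> fin_cases j <;>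
    simp only [Fin.zero_eta, Fin.mk_one, zero_ne_one, one_ne_zero, false_and, and_false, if_false,
      and_self, if_true, add_zero, qHH_tmul, map_smul, TensorProduct.comm_tmul, map_add,
      smul_smul, Units.val_inv_eq_inv_val]
  match_scalars <;> field_simp

theorem braiding_symm_tmul (t : kˣ) (i j : Fin 2) : (braiding t).symm (bV k i ⊗ₜ[k] bV k j) =
    if i = j then (t : k)⁻¹ • (bV k i ⊗ₜ[k] bV k j)
    else if i = 0 then (t : k) • (bV k 1 ⊗ₜ[k] bV k 0) +
      ((t : k)⁻¹ - (t : k) ^ 3) • (bV k 0 ⊗ₜ[k] bV k 1)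
    else (t : k) • (bV k 0 ⊗ₜ[k] bV k 1) := by
  have ht : (t : k) ≠ 0 := t.ne_zero
  -- The proposed inverse is verified by applying the braiding to it.
  rw [LinearEquiv.symm_apply_eq]
  fin_cases i <;> fin_cases j <;>
    simp only [Fin.zero_eta, Fin.mk_one, zero_ne_one, one_ne_zero, if_false,
      if_true, map_smul, map_add, braiding_tmul, smul_smul] <;>
    match_scalars <;> field_simp <;> ring

/-- The canonical element of `V ⊗ V*` corresponds to the identity endomorphism, hence does not
depend on the basis. This is needed because `coevaluation` is defined through an unspecified basis
of `V`. -/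
theorem dualTensorHom_sum_coord {ι : Type*} [Fintype ι] (b : Module.Basis ι k (V k)) :
    dualTensorHom k (V k) (V k) (TensorProduct.comm k _ _ (∑ i, b i ⊗ₜ[k] b.coord i)) =
      LinearMap.id := by
  refine LinearMap.ext fun w => ?_
  simp only [map_sum, TensorProduct.comm_tmul, LinearMap.sum_apply, dualTensorHom_apply,
    Module.Basis.coord_apply, LinearMap.id_apply]
  exact b.sum_repr w

theorem coev_one : coev k 1 = bV k 0 ⊗ₜ[k] bD k 0 + bV k 1 ⊗ₜ[k] bD k 1 := by
  have h := coevaluation_apply_one (K := k) (V := V k)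
  have h0 : bV k 0 ⊗ₜ[k] bD k 0 + bV k 1 ⊗ₜ[k] bD k 1 =
      ∑ i, bV k i ⊗ₜ[k] (bV k).coord i := by
    rw [Fin.sum_univ_two, Module.Basis.coe_dualBasis]
  classical
  rw [coev, h, h0]
  refine (TensorProduct.comm k (V k) (Module.Dual k (V k))).injective
    ((dualTensorHomEquiv k (V k) (V k)).injective ?_)
  exact (dualTensorHom_sum_coord (Module.Basis.ofVectorSpace k (V k))).trans
    (dualTensorHom_sum_coord (bV k)).symm

theorem coevBar_one (t : kˣ) : coevBar t (1 : k) =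
    ((t : k) ^ 2)⁻¹ • (bD k 0 ⊗ₜ[k] bV k 0) + (t : k) ^ 2 • (bD k 1 ⊗ₜ[k] bV k 1) := by
  simp only [coevBar, LinearMap.comp_apply, coev_one, map_add, LinearEquiv.coe_coe,
    TensorProduct.comm_tmul, TensorProduct.map_tmul, rep_gen_basis, LinearMap.id_apply]
  simp [repMatrix]

theorem ev_tmul (i j : Fin 2) : ev k (bD k i ⊗ₜ[k] bV k j) = if j = i then 1 else 0 := by
  rw [ev, contractLeft_apply, bD_bV]

theorem evBar_tmul (t : kˣ) (i j : Fin 2) : evBar t (bV k i ⊗ₜ[k] bD k j) =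
    if i = j then (if i = 0 then (t : k) ^ 2 else ((t : k) ^ 2)⁻¹) else 0 := by
  simp only [evBar, LinearMap.comp_apply, TensorProduct.map_tmul, rep_gen_basis,
    LinearEquiv.coe_coe, TensorProduct.comm_tmul, TensorProduct.tmul_add, TensorProduct.tmul_smul,
    map_add, map_smul,
    ev_tmul, LinearMap.id_apply]
  fin_cases i <;> fin_cases j <;> simp [repMatrix]

theorem isIntertwiner_of_basis {t : kˣ} {M N P ι κ : Type*} [AddCommGroup M] [Module k M]
    [AddCommGroup N] [Module k N] [AddCommGroup P] [Module k P]
    {ρ : Uq t →ₐ[k] Module.End k (M ⊗[k] N)} {σ : Uq t →ₐ[k] Module.End k P}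
    (b : Module.Basis ι k M) (b' : Module.Basis κ k N)
    {f : M ⊗[k] N →ₗ[k] P}
    (h : ∀ x i j, f (ρ (Uq.gen t x) (b i ⊗ₜ b' j)) = σ (Uq.gen t x) (f (b i ⊗ₜ b' j))) :
    IsIntertwiner ρ σ f := by
  refine .of_gen fun x v => ?_
  have h' : f ∘ₗ ρ (Uq.gen t x) = σ (Uq.gen t x) ∘ₗ f := by
    refine (b.tensorProduct b').ext fun p => ?_
    rw [Module.Basis.tensorProduct_apply]
    exact h x p.1 p.2
  exact LinearMap.congr_fun h' v

theorem braiding_isIntertwiner (t : kˣ) :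
    IsIntertwiner (tensorRep t (rep t) (rep t)) (tensorRep t (rep t) (rep t))
      (braiding t).toLinearMap := by
  have ht : (t : k) ≠ 0 := t.ne_zero
  refine isIntertwiner_of_basis (bV k) (bV k) fun x i j => ?_
  cases x <;> fin_cases i <;> fin_cases j <;>
    simp only [Fin.zero_eta, Fin.mk_one, LinearEquiv.coe_coe, tensorRep_E, tensorRep_F,
      tensorRep_K, tensorRep_Kinv, rep_gen_basis, TensorProduct.tmul_add, TensorProduct.add_tmul,
      TensorProduct.tmul_smul, ← TensorProduct.smul_tmul', map_add, map_smul, braiding_tmul,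
      zero_ne_one, one_ne_zero, if_false, if_true] <;>
    simp only [repMatrix, Matrix.of_apply, Matrix.cons_val_zero, Matrix.cons_val_one,
      Matrix.cons_val_fin_one, zero_smul, smul_zero, add_zero, zero_add] <;>
    match_scalars <;> field_simp <;> ring

theorem ev_isIntertwiner (t : kˣ) :
    IsIntertwiner (tensorRep t (dualRep t) (rep t)) (trivialRep t) (ev k) := by
  have ht : (t : k) ≠ 0 := t.ne_zero
  refine isIntertwiner_of_basis (bD k) (bV k) fun x i j => ?_
  cases x <;> fin_cases i <;> fin_cases j <;>
    simp only [Fin.zero_eta, Fin.mk_one, tensorRep_E, tensorRep_F, trivialRep_gen,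
      dualRep_gen_basis, tensorRep_K, tensorRep_Kinv, rep_gen_basis, TensorProduct.tmul_add,
      TensorProduct.add_tmul,
      TensorProduct.tmul_smul, ← TensorProduct.smul_tmul', map_add, map_smul, ev_tmul] <;>
    simp [repMatrix, dualRepMatrix, Uq.counitGen, ht]

/-- The factor `K` in `evBar` is what makes this true: the square of the antipode is conjugation by
`K`, so `v ↦ (f ↦ f (K v))` is a module map from `V` to its double dual. -/
theorem evBar_isIntertwiner (t : kˣ) :
    IsIntertwiner (tensorRep t (rep t) (dualRep t)) (trivialRep t) (evBar t) := by
  have ht : (t : k) ≠ 0 := t.ne_zero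
  refine isIntertwiner_of_basis (bV k) (bD k) fun x i j => ?_
  cases x <;> fin_cases i <;> fin_cases j <;>
    simp only [Fin.zero_eta, Fin.mk_one, tensorRep_E, tensorRep_F, trivialRep_gen,
      dualRep_gen_basis, tensorRep_K, tensorRep_Kinv, rep_gen_basis, TensorProduct.tmul_add,
      TensorProduct.add_tmul,
      TensorProduct.tmul_smul, ← TensorProduct.smul_tmul', map_add, map_smul, evBar_tmul] <;>
    simp [repMatrix, dualRepMatrix, Uq.counitGen, ht]

/-- A linear map out of `k` is determined by the image of `1`, so equivariance only asks that this
vector be invariant. -/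
theorem isIntertwiner_of_one {t : kˣ} {P : Type*} [AddCommGroup P] [Module k P]
    {σ : Uq t →ₐ[k] Module.End k P} {f : k →ₗ[k] P}
    (h : ∀ x, σ (Uq.gen t x) (f 1) = (Uq.counitGen x : k) • f 1) :
    IsIntertwiner (trivialRep t) σ f := by
  refine .of_gen fun x v => ?_
  have hv : v = v • (1 : k) := by simp
  rw [trivialRep_gen, hv, map_smul, map_smul, h, ← map_smul, ← map_smul]
  congr 1
  simp [mul_comm]

theorem coev_isIntertwiner (t : kˣ) :
    IsIntertwiner (trivialRep t) (tensorRep t (rep t) (dualRep t)) (coev k) := by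
  have ht : (t : k) ≠ 0 := t.ne_zero
  refine isIntertwiner_of_one fun x => ?_
  cases x <;>
    simp only [coev_one, tensorRep_E, tensorRep_F, dualRep_gen_basis,
      tensorRep_K, tensorRep_Kinv, rep_gen_basis, TensorProduct.tmul_add, TensorProduct.add_tmul,
      TensorProduct.tmul_smul, ← TensorProduct.smul_tmul', map_add] <;>
    simp only [repMatrix, dualRepMatrix, Uq.counitGen, Matrix.of_apply, Matrix.cons_val_zero,
      Matrix.cons_val_one, Matrix.cons_val_fin_one, zero_smul, smul_zero, add_zero, zero_add] <;>
    match_scalars <;> field_simp <;> ring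

theorem coevBar_isIntertwiner (t : kˣ) :
    IsIntertwiner (trivialRep t) (tensorRep t (dualRep t) (rep t)) (coevBar t) := by
  have ht : (t : k) ≠ 0 := t.ne_zero
  refine isIntertwiner_of_one fun x => ?_
  cases x <;>
    simp only [coevBar_one, tensorRep_E, tensorRep_F, dualRep_gen_basis,
      tensorRep_K, tensorRep_Kinv, rep_gen_basis, TensorProduct.tmul_add, TensorProduct.add_tmul,
      TensorProduct.tmul_smul, ← TensorProduct.smul_tmul', map_add, map_smul] <;>
    simp only [repMatrix, dualRepMatrix, Uq.counitGen, Matrix.of_apply, Matrix.cons_val_zero,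
      Matrix.cons_val_one, Matrix.cons_val_fin_one, zero_smul, smul_zero, add_zero, zero_add] <;>
    match_scalars <;> field_simp <;> ring

end Intertwiners

/-! ### Matrix entries, the action of layers on colourings, and locality. -/

section States

variable {k : Type*} [Field k]

theorem legMap_one (c : Fin 2 → k) (i : Fin 2) : (bV k).repr (legMap c 1) i = c i := by
  fin_cases i <;> simp [legMap]

theorem headMap_bV (d : Fin 2 → k) (i : Fin 2) : headMap d (bV k i) = d i :=
  (bV k).constr_basis k d i

theorem entry_pos (t : kˣ) (c d : Fin 2 → k) (i j l m : Fin 2) :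
    entry t c d .pos [i, j] [l, m] =
      if i = j then (if l = i ∧ m = i then (t : k) else 0)
      else (if l = j ∧ m = i then (t : k)⁻¹ else 0) +
        (if i = 1 ∧ l = 1 ∧ m = 0 then (t : k) - ((t : k) ^ 3)⁻¹ else 0) := by
  rw [entry, braiding_tmul]
  -- Pure tensors of basis vectors are turned back into vectors of the product basis, so that `repr`
  -- can read off coordinates.
  simp only [← Module.Basis.tensorProduct_apply]
  fin_cases i <;> fin_cases j <;> fin_cases l <;> fin_cases m <;>
    simp [-Module.Basis.tensorProduct_apply]

theorem entry_neg (t : kˣ) (c d : Fin 2 → k) (i j l m : Fin 2) :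
    entry t c d .neg [i, j] [l, m] =
      if i = j then (if l = i ∧ m = i then (t : k)⁻¹ else 0)
      else (if l = j ∧ m = i then (t : k) else 0) +
        (if i = 0 ∧ l = 0 ∧ m = 1 then (t : k)⁻¹ - (t : k) ^ 3 else 0) := by
  rw [entry, braiding_symm_tmul]
  simp only [← Module.Basis.tensorProduct_apply]
  fin_cases i <;> fin_cases j <;> fin_cases l <;> fin_cases m <;>
    simp [-Module.Basis.tensorProduct_apply]

theorem entry_capDU (t : kˣ) (c d : Fin 2 → k) (l m : Fin 2) :
    entry t c d .capDU [] [l, m] = if l = m then 1 else 0 := by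
  rw [entry, coev_one]
  simp only [← Module.Basis.tensorProduct_apply]
  fin_cases l <;> fin_cases m <;>
    simp [-Module.Basis.tensorProduct_apply]

theorem entry_capUD (t : kˣ) (c d : Fin 2 → k) (l m : Fin 2) :
    entry t c d .capUD [] [l, m] =
      if l = m then (if l = 0 then ((t : k) ^ 2)⁻¹ else (t : k) ^ 2) else 0 := by
  rw [entry, coevBar_one]
  simp only [← Module.Basis.tensorProduct_apply]
  fin_cases l <;> fin_cases m <;>
    simp [-Module.Basis.tensorProduct_apply]

theorem entry_cupUD (t : kˣ) (c d : Fin 2 → k) (i j : Fin 2) :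
    entry t c d .cupUD [i, j] [] = if i = j then 1 else 0 := by
  rw [entry, ev_tmul]
  simp only [eq_comm]

theorem entry_cupDU (t : kˣ) (c d : Fin 2 → k) (i j : Fin 2) :
    entry t c d .cupDU [i, j] [] =
      if i = j then (if i = 0 then (t : k) ^ 2 else ((t : k) ^ 2)⁻¹) else 0 := by
  rw [entry, evBar_tmul]

theorem entry_leg (t : kˣ) (c d : Fin 2 → k) (l : Fin 2) : entry t c d .leg [] [l] = c l := by
  rw [entry, legMap_one]

theorem entry_head (t : kˣ) (c d : Fin 2 → k) (i : Fin 2) : entry t c d .head [i] [] = d i := by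
  rw [entry, headMap_bV]

theorem sum_colorings_one {M : Type*} [AddCommMonoid M] (F : List (Fin 2) → M) :
    ∑ u : Fin 1 → Fin 2, F (List.ofFn u) = F [0] + F [1] := by
  rw [← (Equiv.funUnique (Fin 1) (Fin 2)).symm.sum_comp, Fin.sum_univ_two]
  rfl

theorem sum_colorings_two {M : Type*} [AddCommMonoid M] (F : List (Fin 2) → M) :
    ∑ u : Fin 2 → Fin 2, F (List.ofFn u) = F [0, 0] + F [0, 1] + (F [1, 0] + F [1, 1]) := by
  rw [← (finTwoArrowEquiv (Fin 2)).symm.sum_comp, Fintype.sum_prod_type, Fin.sum_univ_two,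
    Fin.sum_univ_two, Fin.sum_univ_two]
  rfl

/-- A layer acts on the colours of the strands that enter its piece. -/
theorem layerMap_single (t : kˣ) (c d : Fin 2 → k) (n : ℕ) (g : Piece) {p s q : List (Fin 2)}
    (hp : p.length = n) (hs : s.length = g.dom.length) (a : k) :
    layerMap t c d (n, g) (Finsupp.single (p ++ s ++ q) a) =
      a • ∑ u : Fin g.cod.length → Fin 2,
        Finsupp.single (p ++ List.ofFn u ++ q) (entry t c d g s (List.ofFn u)) := by
  subst hp
  rw [layerMap, Finsupp.linearCombination_single, pieceMap]
  have h1 : (p ++ s ++ q).take p.length = p := by simp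
  have h2 : (p ++ s ++ q).drop (p.length + g.dom.length) = q := by
    rw [← hs, ← List.length_append, List.drop_left]
  have h3 : ((p ++ s ++ q).drop p.length).take g.dom.length = s := by
    rw [← hs, List.append_assoc, List.drop_left, List.take_left]
  simp only [h1, h2, h3, Finsupp.mapDomain_finsetSum, Finsupp.mapDomain_single]

theorem stackMap_nil (t : kˣ) (c d : Fin 2 → k) : stackMap t c d [] = LinearMap.id := rfl

theorem stackMap_append (t : kˣ) (c d : Fin 2 → k) (L L' : List Layer) :
    stackMap t c d (L ++ L') = stackMap t c d L' ∘ₗ stackMap t c d L := by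
  induction L' using List.reverseRecOn with
  | nil => rw [List.append_nil, stackMap_nil, LinearMap.id_comp]
  | append_singleton L' x ih =>
    have h : ∀ M, stackMap t c d (M ++ [x]) = layerMap t c d x ∘ₗ stackMap t c d M := by
      intro M
      simp [stackMap]
    rw [← List.append_assoc, h, ih, h, LinearMap.comp_assoc]

theorem stackMap_cons (t : kˣ) (c d : Fin 2 → k) (x : Layer) (L : List Layer) :
    stackMap t c d (x :: L) = stackMap t c d L ∘ₗ layerMap t c d x :=
  stackMap_append t c d [x] L

/-- The span of the colourings of a row of `m` strands. -/
def rowStates (k : Type*) [Field k] (m : ℕ) : Submodule k (States k) :=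
  Finsupp.supported k k {s | s.length = m}

theorem single_mem_rowStates {m : ℕ} {s : List (Fin 2)} (hs : s.length = m) (a : k) :
    Finsupp.single s a ∈ rowStates k m :=
  Finsupp.single_mem_supported k a hs

theorem rowStates_induction {m : ℕ} {P : States k → Prop} (h0 : P 0)
    (hadd : ∀ f g, P f → P g → P (f + g))
    (hs : ∀ (s : List (Fin 2)) (a : k), s.length = m → P (Finsupp.single s a))
    {f : States k} (hf : f ∈ rowStates k m) : P f := by
  classical
  rw [← Finsupp.sum_single f, Finsupp.sum]
  refine Finset.sum_induction _ P hadd h0 fun s hsf => hs s _ ?_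
  exact (Finsupp.mem_supported k f).mp hf hsf

/-- `States` also contains lists too short for a given layer, on which `layerMap` has no meaning.
Identities of stacks are therefore claimed on rows of sufficient length only, where basis vectors
suffice. -/
theorem eqOn_rowStates {m : ℕ} {N : Type*} [AddCommGroup N] [Module k N]
    {f g : States k →ₗ[k] N}
    (h : ∀ s : List (Fin 2), s.length = m → f (Finsupp.single s 1) = g (Finsupp.single s 1))
    {z : States k} (hz : z ∈ rowStates k m) : f z = g z := by
  refine rowStates_induction (P := fun z => f z = g z) (by simp) (fun _ _ h1 h2 => ?_)
    (fun s a hs => ?_) hz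
  · rw [map_add, map_add, h1, h2]
  · rw [← mul_one a, ← smul_eq_mul, ← Finsupp.smul_single, map_smul, map_smul, h s hs]

theorem exists_split {m n l : ℕ} (s : List (Fin 2)) (hs : s.length = m) (h : n + l ≤ m) :
    ∃ p w q, s = p ++ w ++ q ∧ p.length = n ∧ w.length = l ∧ q.length = m - (n + l) := by
  refine ⟨s.take n, (s.drop n).take l, s.drop (n + l), ?_, ?_, ?_, ?_⟩
  · rw [List.append_assoc, ← List.drop_drop, List.take_append_drop, List.take_append_drop]
  all_goals simp; omega

theorem layerMap_mem (t : kˣ) (c d : Fin 2 → k) {m : ℕ} {x : Layer}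
    (hx : x.1 + x.2.dom.length ≤ m) {z : States k} (hz : z ∈ rowStates k m) :
    layerMap t c d x z ∈ rowStates k (m - x.2.dom.length + x.2.cod.length) := by
  refine rowStates_induction (P := fun z => layerMap t c d x z ∈ rowStates k _) (by simp)
    (fun _ _ h1 h2 => ?_) (fun s a hs => ?_) hz
  · rw [map_add]
    exact add_mem h1 h2
  · obtain ⟨p, w, q, rfl, hp, hw, hq⟩ := exists_split s hs hx
    rw [layerMap_single t c d x.1 x.2 hp hw]
    refine Submodule.smul_mem _ _ (Submodule.sum_mem _ fun u _ => single_mem_rowStates ?_ _)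
    simp
    omega

/-- Each layer has enough strands above it, in a stack below a row of `m` strands. -/
def LengthComposable : ℕ → List Layer → Prop
  | _, [] => True
  | m, x :: L => x.1 + x.2.dom.length ≤ m ∧
      LengthComposable (m - x.2.dom.length + x.2.cod.length) L

/-- The number of strands below a stack. -/
def rowLength (m : ℕ) (L : List Layer) : ℕ :=
  L.foldl (fun m x => m - x.2.dom.length + x.2.cod.length) m

theorem Fits.length_le {w : List Dir} {x : Layer} (h : Fits w x) :
    x.1 + x.2.dom.length ≤ w.length := by
  have h1 := h.1
  have h2 := h.2.length_le
  rw [List.length_drop] at h2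
  omega

theorem length_below {w : List Dir} {x : Layer} (h : Fits w x) :
    (below w x).length = w.length - x.2.dom.length + x.2.cod.length := by
  have h1 := h.length_le
  simp [below]
  omega

/-- Colours of `V` and `V*` are both indexed by `Fin 2`, so the linear maps see only the number of
strands. Directions can be forgotten until weights come in. -/
theorem Composable.lengthComposable {w : List Dir} {L : List Layer} (h : Composable w L) :
    LengthComposable w.length L ∧ (target w L).length = rowLength w.length L := by
  induction L generalizing w with
  | nil => exact ⟨trivial, rfl⟩
  | cons x L ih =>
    have := ih h.2
    rw [length_below h.1] at this
    exact ⟨⟨h.1.length_le, this.1⟩, this.2⟩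

theorem lengthComposable_append {m : ℕ} {L L' : List Layer} :
    LengthComposable m (L ++ L') ↔ LengthComposable m L ∧ LengthComposable (rowLength m L) L' := by
  induction L generalizing m with
  | nil => simp [LengthComposable, rowLength]
  | cons x L ih => simp only [List.cons_append, LengthComposable, ih, rowLength, List.foldl_cons,
      and_assoc]

theorem stackMap_mem (t : kˣ) (c d : Fin 2 → k) {m : ℕ} {L : List Layer}
    (hL : LengthComposable m L) {z : States k} (hz : z ∈ rowStates k m) :
    stackMap t c d L z ∈ rowStates k (rowLength m L) := by
  induction L generalizing m z with
  | nil => exact hz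
  | cons x L ih =>
    rw [stackMap_cons]
    exact ih hL.2 (layerMap_mem t c d hL.1 hz)

/-- Put fixed colours to the left and to the right. -/
def pad (k : Type*) [Field k] (p q : List (Fin 2)) : States k →ₗ[k] States k :=
  Finsupp.lmapDomain k k fun s => p ++ s ++ q

theorem pad_single (p q s : List (Fin 2)) (a : k) :
    pad k p q (Finsupp.single s a) = Finsupp.single (p ++ s ++ q) a := by
  simp [pad, Finsupp.mapDomain_single]

/-- The added colours merge with the strands that already pass to the left and right of the piece;
the entry of the piece is the same on both sides. -/
theorem layerMap_pad (t : kˣ) (c d : Fin 2 → k) {m : ℕ} {x : Layer}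
    (hx : x.1 + x.2.dom.length ≤ m) (p q : List (Fin 2)) {z : States k}
    (hz : z ∈ rowStates k m) :
    layerMap t c d (p.length + x.1, x.2) (pad k p q z) = pad k p q (layerMap t c d x z) := by
  have : ∀ {z}, z ∈ rowStates k m →
      (layerMap t c d (p.length + x.1, x.2) ∘ₗ pad k p q) z =
        (pad k p q ∘ₗ layerMap t c d x) z := by
    refine fun hz => eqOn_rowStates (fun s hs => ?_) hz
    obtain ⟨p', w, q', rfl, hp, hw, hq⟩ := exists_split s hs hx
    rw [LinearMap.comp_apply, LinearMap.comp_apply, pad_single,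
      layerMap_single t c d x.1 x.2 hp hw]
    have h : p ++ (p' ++ w ++ q') ++ q = (p ++ p') ++ w ++ (q' ++ q) := by simp
    rw [h, layerMap_single t c d _ x.2 (by simp [hp]) hw]
    simp [pad_single]
  exact this hz

/-- A stack acts locally: strands to its left and right keep their colours. -/
theorem stackMap_shift_pad (t : kˣ) (c d : Fin 2 → k) {m : ℕ} {L : List Layer}
    (hL : LengthComposable m L) (p q : List (Fin 2)) {z : States k} (hz : z ∈ rowStates k m) :
    stackMap t c d (shift p.length L) (pad k p q z) = pad k p q (stackMap t c d L z) := by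
  induction L generalizing m z with
  | nil => rfl
  | cons x L ih =>
    have h : shift p.length (x :: L) = (p.length + x.1, x.2) :: shift p.length L := rfl
    rw [h, stackMap_cons, stackMap_cons, LinearMap.comp_apply, LinearMap.comp_apply,
      layerMap_pad t c d hL.1 p q hz, ih hL.2 (layerMap_mem t c d hL.1 hz)]

end States

/-! ### The local moves as identities on a few strands. -/

section LocalMoves

variable {k : Type*} [Field k]

theorem pieceMap_pos (t : kˣ) (c d : Fin 2 → k) (i j : Fin 2) : pieceMap t c d .pos [i, j] =
    if i = j then (t : k) • Finsupp.single [i, i] (1 : k)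
    else if i = 0 then (t : k)⁻¹ • Finsupp.single [1, 0] (1 : k)
    else (t : k)⁻¹ • Finsupp.single [0, 1] (1 : k) +
      ((t : k) - ((t : k) ^ 3)⁻¹) • Finsupp.single [1, 0] (1 : k) := by
  refine (sum_colorings_two fun u => Finsupp.single u (entry t c d .pos [i, j] u)).trans ?_
  fin_cases i <;> fin_cases j <;>
    simp [entry_pos]

theorem pieceMap_neg (t : kˣ) (c d : Fin 2 → k) (i j : Fin 2) : pieceMap t c d .neg [i, j] =
    if i = j then (t : k)⁻¹ • Finsupp.single [i, i] (1 : k)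
    else if i = 0 then (t : k) • Finsupp.single [1, 0] (1 : k) +
      ((t : k)⁻¹ - (t : k) ^ 3) • Finsupp.single [0, 1] (1 : k)
    else (t : k) • Finsupp.single [0, 1] (1 : k) := by
  refine (sum_colorings_two fun u => Finsupp.single u (entry t c d .neg [i, j] u)).trans ?_
  fin_cases i <;> fin_cases j <;>
    simp [entry_neg, add_comm]

theorem pieceMap_capDU (t : kˣ) (c d : Fin 2 → k) : pieceMap t c d .capDU [] =
    Finsupp.single [0, 0] (1 : k) + Finsupp.single [1, 1] (1 : k) := by
  refine (sum_colorings_two fun u => Finsupp.single u (entry t c d .capDU [] u)).trans ?_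
  simp [entry_capDU]

theorem pieceMap_capUD (t : kˣ) (c d : Fin 2 → k) : pieceMap t c d .capUD [] =
    ((t : k) ^ 2)⁻¹ • Finsupp.single [0, 0] (1 : k) +
      (t : k) ^ 2 • Finsupp.single [1, 1] (1 : k) := by
  refine (sum_colorings_two fun u => Finsupp.single u (entry t c d .capUD [] u)).trans ?_
  simp [entry_capUD]

theorem pieceMap_cupUD (t : kˣ) (c d : Fin 2 → k) (i j : Fin 2) :
    pieceMap t c d .cupUD [i, j] = if i = j then Finsupp.single [] (1 : k) else 0 := by
  -- With the length visibly zero, the sum runs over the single empty colouring.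
  rw [pieceMap, show Piece.cupUD.cod.length = 0 from rfl]
  fin_cases i <;> fin_cases j <;> simp [entry_cupUD]

theorem pieceMap_cupDU (t : kˣ) (c d : Fin 2 → k) (i j : Fin 2) :
    pieceMap t c d .cupDU [i, j] =
      if i = j then
        (if i = 0 then (t : k) ^ 2 else ((t : k) ^ 2)⁻¹) • Finsupp.single [] (1 : k)
      else 0 := by
  rw [pieceMap, show Piece.cupDU.cod.length = 0 from rfl]
  fin_cases i <;> fin_cases j <;> simp [entry_cupDU]

theorem pieceMap_leg (t : kˣ) (c d : Fin 2 → k) : pieceMap t c d .leg [] =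
    c 0 • Finsupp.single [0] (1 : k) + c 1 • Finsupp.single [1] (1 : k) := by
  refine (sum_colorings_one fun u => Finsupp.single u (entry t c d .leg [] u)).trans ?_
  simp [entry_leg]

theorem pieceMap_head (t : kˣ) (c d : Fin 2 → k) (i : Fin 2) :
    pieceMap t c d .head [i] = d i • Finsupp.single [] (1 : k) := by
  rw [pieceMap, show Piece.head.cod.length = 0 from rfl]
  simp [entry_head]

theorem layerMap_single_one (t : kˣ) (c d : Fin 2 → k) (n : ℕ) (g : Piece) (s : List (Fin 2)) :
    layerMap t c d (n, g) (Finsupp.single s 1) =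
      Finsupp.lmapDomain k k (fun u => s.take n ++ u ++ s.drop (n + g.dom.length))
        (pieceMap t c d g ((s.drop n).take g.dom.length)) := by
  rw [layerMap, Finsupp.linearCombination_single, one_smul]
  rfl

/-- Disjoint layers commute. -/
theorem layerMap_interchange (t : kˣ) (c d : Fin 2 → k) (i j : ℕ) (g h : Piece) {m : ℕ}
    (hm : i + g.dom.length + j + h.dom.length ≤ m) {z : States k} (hz : z ∈ rowStates k m) :
    layerMap t c d (i + g.cod.length + j, h) (layerMap t c d (i, g) z) =
      layerMap t c d (i, g) (layerMap t c d (i + g.dom.length + j, h) z) := by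
  have key : ∀ s : List (Fin 2), s.length = m →
      (layerMap t c d (i + g.cod.length + j, h) ∘ₗ layerMap t c d (i, g)) (Finsupp.single s 1) =
        (layerMap t c d (i, g) ∘ₗ layerMap t c d (i + g.dom.length + j, h))
          (Finsupp.single s 1) := by
    intro s hs
    -- The row is cut as `p, w₁, v, w₂, q`: the piece `g` acts on `w₁`, the piece `h` on `w₂`, and
    -- `v` is the colouring of the `j` strands between them.
    obtain ⟨r, w₂, q, rfl, hr, hw₂, -⟩ := exists_split s hs hm
    obtain ⟨p, w₁, v, rfl, hp, hw₁, hv⟩ := exists_split r hr (Nat.le_add_right _ j)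
    simp only [LinearMap.comp_apply]
    have e₁ : p ++ w₁ ++ v ++ w₂ ++ q = p ++ w₁ ++ (v ++ w₂ ++ q) := by simp
    rw [layerMap_single t c d _ h hr hw₂, e₁, layerMap_single t c d _ g hp hw₁]
    simp only [one_smul, map_sum]
    have e₂ : ∀ u : Fin g.cod.length → Fin 2, ∀ a : k,
        layerMap t c d (i + g.cod.length + j, h)
            (Finsupp.single (p ++ List.ofFn u ++ (v ++ w₂ ++ q)) a) =
          a • ∑ u' : Fin h.cod.length → Fin 2,
            Finsupp.single (p ++ List.ofFn u ++ v ++ List.ofFn u' ++ q)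
              (entry t c d h w₂ (List.ofFn u')) := by
      intro u a
      have e : p ++ List.ofFn u ++ (v ++ w₂ ++ q) = (p ++ List.ofFn u ++ v) ++ w₂ ++ q := by simp
      rw [e, layerMap_single t c d _ h (by simp; omega) hw₂]
    have e₃ : ∀ u' : Fin h.cod.length → Fin 2, ∀ a : k,
        layerMap t c d (i, g) (Finsupp.single (p ++ w₁ ++ v ++ List.ofFn u' ++ q) a) =
          a • ∑ u : Fin g.cod.length → Fin 2,
            Finsupp.single (p ++ List.ofFn u ++ v ++ List.ofFn u' ++ q)
              (entry t c d g w₁ (List.ofFn u)) := by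
      intro u a
      have e : p ++ w₁ ++ v ++ List.ofFn u ++ q = p ++ w₁ ++ (v ++ List.ofFn u ++ q) := by simp
      rw [e, layerMap_single t c d _ g hp hw₁]
      simp
    simp only [e₂, e₃, Finset.smul_sum, Finsupp.smul_single, smul_eq_mul]
    -- Both orders give the same double sum over the new colours of `g` and `h`, with the product of
    -- the two entries as coefficient.
    rw [Finset.sum_comm]
    simp only [mul_comm]
  exact eqOn_rowStates key hz

theorem lmapDomain_single (f : List (Fin 2) → List (Fin 2)) (s : List (Fin 2)) (a : k) :
    Finsupp.lmapDomain k k f (Finsupp.single s a) = Finsupp.single (f s) a := by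
  rw [Finsupp.lmapDomain_apply, Finsupp.mapDomain_single]

theorem stackMap_zigzag_down (t : kˣ) (c d : Fin 2 → k) (a : Fin 2) :
    stackMap t c d [(0, .capDU), (1, .cupUD)] (Finsupp.single [a] 1) = Finsupp.single [a] 1 := by
  fin_cases a <;>
    simp [stackMap_cons, stackMap_nil, layerMap_single_one,
      lmapDomain_single, Piece.dom, pieceMap_capDU, pieceMap_cupUD, -Finsupp.lmapDomain_apply]

/-- The weight `K⁻¹` of the maximum cancels the weight `K` of the minimum. -/
theorem stackMap_zigzag_down' (t : kˣ) (c d : Fin 2 → k) (a : Fin 2) :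
    stackMap t c d [(1, .capUD), (0, .cupDU)] (Finsupp.single [a] 1) = Finsupp.single [a] 1 := by
  fin_cases a <;>
    simp [stackMap_cons, stackMap_nil, layerMap_single_one,
      lmapDomain_single, Piece.dom, pieceMap_capUD, pieceMap_cupDU, smul_smul,
      -Finsupp.lmapDomain_apply, -Finsupp.smul_single]

theorem stackMap_zigzag_up (t : kˣ) (c d : Fin 2 → k) (a : Fin 2) :
    stackMap t c d [(1, .capDU), (0, .cupUD)] (Finsupp.single [a] 1) = Finsupp.single [a] 1 := by
  fin_cases a <;>
    simp [stackMap_cons, stackMap_nil, layerMap_single_one,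
      lmapDomain_single, Piece.dom, pieceMap_capDU, pieceMap_cupUD, -Finsupp.lmapDomain_apply]

theorem stackMap_zigzag_up' (t : kˣ) (c d : Fin 2 → k) (a : Fin 2) :
    stackMap t c d [(0, .capUD), (1, .cupDU)] (Finsupp.single [a] 1) = Finsupp.single [a] 1 := by
  fin_cases a <;>
    simp [stackMap_cons, stackMap_nil, layerMap_single_one,
      lmapDomain_single, Piece.dom, pieceMap_capUD, pieceMap_cupDU, smul_smul,
      -Finsupp.lmapDomain_apply, -Finsupp.smul_single]

/-- The factor of a curl. -/
def twist (t : kˣ) (s : Bool) : k := if s then (t : k) ^ 3 else ((t : k) ^ 3)⁻¹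

/-- The curl is a partial trace of the crossing weighted by `K`. For a positive crossing, colour `0`
receives `t · t²`, and colour `1` receives `t · t⁻² + (t - t⁻³) · t²`; both equal `t³`. -/
theorem stackMap_kinkRight (t : kˣ) (c d : Fin 2 → k) (s : Bool) (a : Fin 2) :
    stackMap t c d (kinkRight (crossing s)) (Finsupp.single [a] 1) =
      twist t s • Finsupp.single [a] 1 := by
  have ht : (t : k) ≠ 0 := t.ne_zero
  cases s <;> fin_cases a <;>
    simp [kinkRight, crossing, twist, stackMap_cons, stackMap_nil, layerMap_single_one,
      lmapDomain_single, Piece.dom, pieceMap_pos, pieceMap_neg, pieceMap_capDU, pieceMap_cupDU,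
      smul_smul, -Finsupp.lmapDomain_apply, -Finsupp.smul_single] <;>
    first
      | (field_simp; done)
      | (match_scalars <;> first | ring1 | (field_simp; done) | (field_simp; ring1))

/-- The trace is now over the left strand and weighted by `K⁻¹`. It is the same scalar as on the
right, which is the move `R1'`. -/
theorem stackMap_kinkLeft (t : kˣ) (c d : Fin 2 → k) (s : Bool) (a : Fin 2) :
    stackMap t c d (kinkLeft (crossing s)) (Finsupp.single [a] 1) =
      twist t s • Finsupp.single [a] 1 := by
  have ht : (t : k) ≠ 0 := t.ne_zero
  cases s <;> fin_cases a <;>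
    simp [kinkLeft, crossing, twist, stackMap_cons, stackMap_nil, layerMap_single_one,
      lmapDomain_single, Piece.dom, pieceMap_pos, pieceMap_neg, pieceMap_capUD, pieceMap_cupUD,
      smul_smul, -Finsupp.lmapDomain_apply, -Finsupp.smul_single] <;>
    first
      | (field_simp; done)
      | (match_scalars <;> first | ring1 | (field_simp; done) | (field_simp; ring1))

theorem stackMap_r2 (t : kˣ) (c d : Fin 2 → k) (s : Bool) (a b : Fin 2) :
    stackMap t c d [(0, crossing s), (0, crossing !s)] (Finsupp.single [a, b] 1) =
      Finsupp.single [a, b] 1 := by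
  have ht : (t : k) ≠ 0 := t.ne_zero
  cases s <;> fin_cases a <;> fin_cases b <;>
    simp [crossing, stackMap_cons, stackMap_nil, layerMap_single_one,
      lmapDomain_single, Piece.dom, pieceMap_pos, pieceMap_neg, smul_smul,
      -Finsupp.lmapDomain_apply, -Finsupp.smul_single] <;>
    first
      | (field_simp; done)
      | (match_scalars <;> first | ring1 | (field_simp; done) | (field_simp; ring1))

/-- The turned crossings are partial transposes of the braiding and its inverse. They are inverse to
each other only thanks to the weights `K⁻¹` and `K` of the maximum and minimum in `sideDU`. -/
theorem stackMap_r2_anti (t : kˣ) (c d : Fin 2 → k) (s : Bool) (a b : Fin 2) :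
    stackMap t c d (sideUD (crossing s) ++ sideDU (crossing !s)) (Finsupp.single [a, b] 1) =
      Finsupp.single [a, b] 1 := by
  have ht : (t : k) ≠ 0 := t.ne_zero
  rw [stackMap_append, LinearMap.comp_apply]
  cases s <;> fin_cases a <;> fin_cases b <;>
    simp [sideUD, sideDU, crossing, stackMap_cons, stackMap_nil, layerMap_single_one,
      lmapDomain_single, Piece.dom, pieceMap_pos, pieceMap_neg, pieceMap_capDU, pieceMap_capUD,
      pieceMap_cupDU, pieceMap_cupUD,
      smul_smul, -Finsupp.lmapDomain_apply, -Finsupp.smul_single] <;>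
    first
      | (field_simp; done)
      | (match_scalars <;> first | ring1 | (field_simp; done) | (field_simp; ring1))

theorem stackMap_r2_anti' (t : kˣ) (c d : Fin 2 → k) (s : Bool) (a b : Fin 2) :
    stackMap t c d (sideDU (crossing s) ++ sideUD (crossing !s)) (Finsupp.single [a, b] 1) =
      Finsupp.single [a, b] 1 := by
  have ht : (t : k) ≠ 0 := t.ne_zero
  rw [stackMap_append, LinearMap.comp_apply]
  cases s <;> fin_cases a <;> fin_cases b <;>
    simp [sideUD, sideDU, crossing, stackMap_cons, stackMap_nil, layerMap_single_one,
      lmapDomain_single, Piece.dom, pieceMap_pos, pieceMap_neg, pieceMap_capDU, pieceMap_capUD,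
      pieceMap_cupDU, pieceMap_cupUD,
      smul_smul, -Finsupp.lmapDomain_apply, -Finsupp.smul_single] <;>
    first
      | (field_simp; done)
      | (match_scalars <;> first | ring1 | (field_simp; done) | (field_simp; ring1))

theorem stackMap_r3 (t : kˣ) (c d : Fin 2 → k) (a b e : Fin 2) :
    stackMap t c d [(0, .pos), (1, .pos), (0, .pos)] (Finsupp.single [a, b, e] 1) =
      stackMap t c d [(1, .pos), (0, .pos), (1, .pos)] (Finsupp.single [a, b, e] 1) := by
  have ht : (t : k) ≠ 0 := t.ne_zero
  fin_cases a <;> fin_cases b <;> fin_cases e <;>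
    simp [stackMap_cons, stackMap_nil, layerMap_single_one,
      lmapDomain_single, Piece.dom, pieceMap_pos, smul_smul, -Finsupp.lmapDomain_apply,
      -Finsupp.smul_single] <;>
    first
      | (field_simp; done)
      | (match_scalars <;> first | ring1 | (field_simp; done) | (field_simp; ring1))

/-- Evaluating the nested maxima and minima beforehand leaves four colourings around the crossing in
`stackMap_rotate`. -/
theorem stackMap_nested_capDU (t : kˣ) (c d : Fin 2 → k) (a b : Fin 2) :
    stackMap t c d [(2, .capDU), (3, .capDU)] (Finsupp.single [a, b] 1) =
      Finsupp.single [a, b, 0, 0, 0, 0] (1 : k) + Finsupp.single [a, b, 0, 1, 1, 0] (1 : k) +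
      (Finsupp.single [a, b, 1, 0, 0, 1] (1 : k) + Finsupp.single [a, b, 1, 1, 1, 1] (1 : k)) := by
  simp [stackMap_cons, stackMap_nil, layerMap_single_one, lmapDomain_single, Piece.dom,
    pieceMap_capDU, -Finsupp.lmapDomain_apply]

theorem stackMap_nested_cupUD (t : kˣ) (c d : Fin 2 → k) (a b l m : Fin 2) (q : List (Fin 2)) :
    stackMap t c d [(1, .cupUD), (0, .cupUD)] (Finsupp.single (a :: b :: l :: m :: q) 1) =
      if b = l ∧ a = m then Finsupp.single q 1 else 0 := by
  by_cases h : b = l <;> by_cases h' : a = m <;>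
    simp [h, h', stackMap_cons, stackMap_nil, layerMap_single_one,
      lmapDomain_single, Piece.dom, pieceMap_cupUD, -Finsupp.lmapDomain_apply]

theorem stackMap_nested_capUD (t : kˣ) (c d : Fin 2 → k) (q : List (Fin 2)) :
    stackMap t c d [(0, .capUD), (1, .capUD)] (Finsupp.single q 1) =
      ((t : k) ^ 4)⁻¹ • Finsupp.single ([0, 0, 0, 0] ++ q) (1 : k) +
        Finsupp.single ([0, 1, 1, 0] ++ q) (1 : k) +
      (Finsupp.single ([1, 0, 0, 1] ++ q) (1 : k) +
        (t : k) ^ 4 • Finsupp.single ([1, 1, 1, 1] ++ q) (1 : k)) := by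
  have ht : (t : k) ≠ 0 := t.ne_zero
  simp [stackMap_cons, stackMap_nil, layerMap_single_one, lmapDomain_single, Piece.dom,
    pieceMap_capUD, smul_smul, -Finsupp.lmapDomain_apply, -Finsupp.smul_single, ht]
  field_simp

theorem stackMap_nested_cupDU (t : kˣ) (c d : Fin 2 → k) (a b l m i j : Fin 2) :
    stackMap t c d [(3, .cupDU), (2, .cupDU)] (Finsupp.single [i, j, l, m, a, b] 1) =
      if m = a ∧ l = b then
        ((if a = 0 then (t : k) ^ 2 else ((t : k) ^ 2)⁻¹) *
          (if b = 0 then (t : k) ^ 2 else ((t : k) ^ 2)⁻¹)) • Finsupp.single [i, j] (1 : k)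
      else 0 := by
  by_cases h : m = a <;> by_cases h' : l = b <;>
    simp [h, h', stackMap_cons, stackMap_nil, layerMap_single_one,
      lmapDomain_single, Piece.dom, pieceMap_cupDU, -ite_smul, -Finsupp.lmapDomain_apply,
      -Finsupp.smul_single, smul_smul]

/-- The left side is the plain transpose of the crossing. On the right side the maxima add `K⁻¹ ⊗
K⁻¹` and the minima `K ⊗ K`; these cancel because the crossing commutes with `K ⊗ K`. -/
theorem stackMap_rotate (t : kˣ) (c d : Fin 2 → k) (s : Bool) (a b : Fin 2) :
    stackMap t c d [(2, .capDU), (3, .capDU), (2, crossing s), (1, .cupUD), (0, .cupUD)]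
        (Finsupp.single [a, b] 1) =
      stackMap t c d [(0, .capUD), (1, .capUD), (2, crossing s), (3, .cupDU), (2, .cupDU)]
        (Finsupp.single [a, b] 1) := by
  have ht : (t : k) ≠ 0 := t.ne_zero
  have e₁ := stackMap_append t c d [(2, .capDU), (3, .capDU)]
    [(2, crossing s), (1, .cupUD), (0, .cupUD)]
  have e₂ := stackMap_append t c d [(0, .capUD), (1, .capUD)]
    [(2, crossing s), (3, .cupDU), (2, .cupDU)]
  simp only [List.cons_append, List.nil_append] at e₁ e₂
  rw [e₁, e₂, stackMap_cons, stackMap_cons _ _ _ (2, crossing s)]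
  simp only [LinearMap.comp_apply, stackMap_nested_capDU, stackMap_nested_capUD, map_add, map_smul]
  cases s <;>
    simp only [crossing, layerMap_single_one, Piece.dom, List.length_cons, List.length_nil,
      zero_add, Nat.reduceAdd, List.cons_append, List.nil_append, List.take_succ_cons,
      List.take_zero, List.drop_succ_cons, List.drop_zero, pieceMap_pos, pieceMap_neg, if_true,
      Bool.false_eq_true, if_false, zero_ne_one, one_ne_zero, map_add, map_smul, lmapDomain_single,
      stackMap_nested_cupUD, stackMap_nested_cupDU] <;>
    fin_cases a <;> fin_cases b <;> simp [-Finsupp.smul_single, smul_smul] <;> first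
      | (field_simp; done)
      | (match_scalars <;> ring1)

end LocalMoves

/-! ### Invariance under local moves, the skein relation, and the factors of curls and links. -/

section Invariance

variable {k : Type*} [Field k]

/-- Two stacks that agree on the colourings of `l` strands agree when strands are added on both
sides. -/
theorem stackMap_shift_congr {t : kˣ} {c d c' d' : Fin 2 → k} {l m n : ℕ} {u v : List Layer}
    (hu : LengthComposable l u) (hv : LengthComposable l v)
    (h : ∀ s : List (Fin 2), s.length = l →
      stackMap t c d u (Finsupp.single s 1) = stackMap t c' d' v (Finsupp.single s 1))
    (hm : n + l ≤ m) {z : States k} (hz : z ∈ rowStates k m) :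
    stackMap t c d (shift n u) z = stackMap t c' d' (shift n v) z := by
  refine eqOn_rowStates (fun s hs => ?_) hz
  obtain ⟨p, w, q, rfl, rfl, hw, -⟩ := exists_split s hs hm
  rw [← pad_single, stackMap_shift_pad t c d hu p q (single_mem_rowStates hw 1),
    stackMap_shift_pad t c' d' hv p q (single_mem_rowStates hw 1), h w hw]

/-- A stack that is a scalar on the colourings of `l` strands remains one when strands are added on
both sides. -/
theorem stackMap_shift_eq_smul {t : kˣ} {c d : Fin 2 → k} {l m n : ℕ} {u : List Layer} {a : k}
    (hu : LengthComposable l u)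
    (h : ∀ s : List (Fin 2), s.length = l →
      stackMap t c d u (Finsupp.single s 1) = a • Finsupp.single s 1)
    (hm : n + l ≤ m) {z : States k} (hz : z ∈ rowStates k m) :
    stackMap t c d (shift n u) z = a • z := by
  refine eqOn_rowStates (g := a • LinearMap.id) (fun s hs => ?_) hz
  obtain ⟨p, w, q, rfl, rfl, hw, -⟩ := exists_split s hs hm
  rw [← pad_single, stackMap_shift_pad t c d hu p q (single_mem_rowStates hw 1), h w hw, map_smul]
  rfl

theorem forall_length_one {P : List (Fin 2) → Prop} (h : ∀ a, P [a]) (s : List (Fin 2))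
    (hs : s.length = 1) : P s := by
  obtain ⟨a, rfl⟩ := List.length_eq_one_iff.mp hs
  exact h a

theorem forall_length_two {P : List (Fin 2) → Prop} (h : ∀ a b, P [a, b]) (s : List (Fin 2))
    (hs : s.length = 2) : P s := by
  obtain ⟨a, b, rfl⟩ := List.length_eq_two.mp hs
  exact h a b

theorem forall_length_three {P : List (Fin 2) → Prop} (h : ∀ a b e, P [a, b, e])
    (s : List (Fin 2)) (hs : s.length = 3) : P s := by
  obtain ⟨a, b, e, rfl⟩ := List.length_eq_three.mp hs
  exact h a b e

/-- Local moves do not change the linear map. -/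
theorem LocalMove.stackMap_eq (t : kˣ) (c d : Fin 2 → k) {u v : List Layer} (h : LocalMove u v)
    {m n : ℕ} (hu : LengthComposable m (shift n u)) {z : States k} (hz : z ∈ rowStates k m) :
    stackMap t c d (shift n u) z = stackMap t c d (shift n v) z := by
  cases h with
  | interchange i j g h =>
    -- The number `j` of strands between the two pieces is arbitrary, so there is no row of fixed
    -- length to check. The bound for the second layer involves a truncated subtraction, which the
    -- bound for the first layer makes exact.
    have hm := hu.2.1
    have hm' := hu.1
    simp only [shift, List.map_cons, List.map_nil, stackMap_cons, stackMap_nil,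
      LinearMap.comp_apply, LinearMap.id_apply, ← add_assoc] at hm hm' ⊢
    exact layerMap_interchange t c d (n + i) j g h (by omega) hz
  | zigzag_down =>
    refine stackMap_shift_congr (l := 1) ?_ ?_
      (forall_length_one (stackMap_zigzag_down t c d)) ?_ hz <;>
      simp [LengthComposable, shift, Piece.dom, Piece.cod] at hu ⊢ <;> omega
  | zigzag_down' =>
    refine stackMap_shift_congr (l := 1) ?_ ?_
      (forall_length_one (stackMap_zigzag_down' t c d)) ?_ hz <;>
      simp [LengthComposable, shift, Piece.dom, Piece.cod] at hu ⊢ <;> omega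
  | zigzag_up =>
    refine stackMap_shift_congr (l := 1) ?_ ?_
      (forall_length_one (stackMap_zigzag_up t c d)) ?_ hz <;>
      simp [LengthComposable, shift, Piece.dom, Piece.cod] at hu ⊢ <;> omega
  | zigzag_up' =>
    refine stackMap_shift_congr (l := 1) ?_ ?_
      (forall_length_one (stackMap_zigzag_up' t c d)) ?_ hz <;>
      simp [LengthComposable, shift, Piece.dom, Piece.cod] at hu ⊢ <;> omega
  | rotate s =>
    refine stackMap_shift_congr (l := 2) ?_ ?_
      (forall_length_two (stackMap_rotate t c d s)) ?_ hz <;>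
      cases s <;> simp [LengthComposable, shift, crossing, Piece.dom, Piece.cod] at hu ⊢ <;> omega
  | r1' s =>
    refine stackMap_shift_congr (l := 1) ?_ ?_
      (forall_length_one fun a => (stackMap_kinkRight t c d s a).trans
        (stackMap_kinkLeft t c d s a).symm) ?_ hz <;>
      cases s <;> simp [LengthComposable, shift, crossing, kinkRight, kinkLeft, Piece.dom,
        Piece.cod] at hu ⊢ <;> omega
  | r2 s =>
    refine stackMap_shift_congr (l := 2) ?_ ?_
      (forall_length_two (stackMap_r2 t c d s)) ?_ hz <;>
      cases s <;> simp [LengthComposable, shift, crossing, Piece.dom, Piece.cod] at hu ⊢ <;> omega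
  | r2_anti s =>
    refine stackMap_shift_congr (l := 2) ?_ ?_
      (forall_length_two (stackMap_r2_anti t c d s)) ?_ hz <;>
      cases s <;> simp [LengthComposable, shift, crossing, sideUD, sideDU, Piece.dom,
        Piece.cod] at hu ⊢ <;> omega
  | r2_anti' s =>
    refine stackMap_shift_congr (l := 2) ?_ ?_
      (forall_length_two (stackMap_r2_anti' t c d s)) ?_ hz <;>
      cases s <;> simp [LengthComposable, shift, crossing, sideUD, sideDU, Piece.dom,
        Piece.cod] at hu ⊢ <;> omega
  | r3 =>
    refine stackMap_shift_congr (l := 3) ?_ ?_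
      (forall_length_three (stackMap_r3 t c d)) ?_ hz <;>
      simp [LengthComposable, shift, Piece.dom, Piece.cod] at hu ⊢ <;> omega

theorem IsClosedStack.lengthComposable {L : List Layer} (h : IsClosedStack L) :
    LengthComposable 0 L := h.1.lengthComposable.1

/-- The vector that arises above some part of a closed stack. -/
theorem stackMap_pre_mem (t : kˣ) (c d : Fin 2 → k) {pre L : List Layer}
    (h : LengthComposable 0 (pre ++ L)) :
    LengthComposable (rowLength 0 pre) L ∧
      stackMap t c d pre (Finsupp.single [] 1) ∈ rowStates k (rowLength 0 pre) := by
  rw [lengthComposable_append] at h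
  exact ⟨h.2, stackMap_mem t c d h.1 (single_mem_rowStates rfl 1)⟩

theorem phi_append (t : kˣ) (c d : Fin 2 → k) (pre u post : List Layer) :
    phi t c d (pre ++ u ++ post) =
      stackMap t c d post (stackMap t c d u (stackMap t c d pre (Finsupp.single [] 1))) [] := by
  rw [phi, stackMap_append, stackMap_append]
  rfl

theorem phi_eq_of_localMove (t : kˣ) (c d : Fin 2 → k) {D D' : MultiDiagram}
    {pre post u v : List Layer} {n : ℕ} (h : LocalMove u v)
    (hD : D.layers = pre ++ shift n u ++ post) (hD' : D'.layers = pre ++ shift n v ++ post) :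
    phi t c d D.layers = phi t c d D'.layers := by
  have hL := D.isClosed.lengthComposable
  rw [hD, List.append_assoc] at hL
  have hpre := stackMap_pre_mem t c d hL
  rw [hD, hD', phi_append, phi_append,
    h.stackMap_eq t c d (lengthComposable_append.mp hpre.1).1 hpre.2]

/-- By linearity of `post`, a scalar inserted at any height factors out. Curls, links and circles
are all treated in this way. -/
theorem phi_eq_smul (t : kˣ) (c d : Fin 2 → k) {D D₀ : MultiDiagram} {pre post u : List Layer}
    {a : k} (hD : D.layers = pre ++ u ++ post) (hD₀ : D₀.layers = pre ++ post)
    (h : ∀ m, LengthComposable m u → ∀ z ∈ rowStates k m, stackMap t c d u z = a • z) :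
    phi t c d D.layers = a * phi t c d D₀.layers := by
  have hL := D.isClosed.lengthComposable
  rw [hD, List.append_assoc] at hL
  have hpre := stackMap_pre_mem t c d hL
  have h0 : pre ++ post = pre ++ [] ++ post := by simp
  rw [hD, hD₀, h0, phi_append, phi_append, h _ (lengthComposable_append.mp hpre.1).1 _ hpre.2,
    map_smul]
  rfl

/-- This is the quadratic relation `(X - t²)(X + t⁻²) = 0` for `X = t • Ψ`, divided by `X`. By
locality it is checked on the four colourings of two strands. -/
theorem stackMap_skein (t : kˣ) (c d : Fin 2 → k) {m n : ℕ} (hm : n + 2 ≤ m) {z : States k}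
    (hz : z ∈ rowStates k m) :
    (t : k) • stackMap t c d [(n, .pos)] z - (t : k)⁻¹ • stackMap t c d [(n, .neg)] z =
      ((t : k) ^ 2 - ((t : k) ^ 2)⁻¹) • z := by
  have ht : (t : k) ≠ 0 := t.ne_zero
  refine eqOn_rowStates (f := (t : k) • stackMap t c d [(n, .pos)] -
    (t : k)⁻¹ • stackMap t c d [(n, .neg)])
    (g := ((t : k) ^ 2 - ((t : k) ^ 2)⁻¹) • LinearMap.id) (fun s hs => ?_) hz
  obtain ⟨p, w, q, rfl, rfl, hw, -⟩ := exists_split s hs hm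
  have hpos := stackMap_shift_pad t c d (m := 2) (L := [(0, .pos)]) ⟨by simp [Piece.dom], trivial⟩
    p q (single_mem_rowStates hw 1)
  have hneg := stackMap_shift_pad t c d (m := 2) (L := [(0, .neg)]) ⟨by simp [Piece.dom], trivial⟩
    p q (single_mem_rowStates hw 1)
  simp only [shift, List.map_cons, List.map_nil, add_zero] at hpos hneg
  simp only [LinearMap.sub_apply, LinearMap.smul_apply, LinearMap.id_apply]
  rw [← pad_single, hpos, hneg, ← (pad k p q).map_smul, ← (pad k p q).map_smul, ← map_sub,
    ← (pad k p q).map_smul]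
  congr 1
  obtain ⟨a, b, rfl⟩ := List.length_eq_two.mp hw
  fin_cases a <;> fin_cases b <;>
    simp [stackMap_cons, stackMap_nil, layerMap_single_one,
      lmapDomain_single, Piece.dom, pieceMap_pos, pieceMap_neg, smul_smul,
      -Finsupp.lmapDomain_apply, -Finsupp.smul_single] <;>
    first
      | (field_simp; done)
      | (match_scalars <;> first | ring1 | (field_simp; ring1))

theorem phi_skein (t : kˣ) (c d : Fin 2 → k) {Dp Dn D₀ : MultiDiagram} {pre post : List Layer}
    {n : ℕ} (hp : Dp.layers = pre ++ [(n, .pos)] ++ post)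
    (hn : Dn.layers = pre ++ [(n, .neg)] ++ post) (h0 : D₀.layers = pre ++ post) :
    (t : k) * phi t c d Dp.layers - (t : k)⁻¹ * phi t c d Dn.layers =
      ((t : k) ^ 2 - ((t : k) ^ 2)⁻¹) * phi t c d D₀.layers := by
  have hL := Dp.isClosed.lengthComposable
  rw [hp, List.append_assoc] at hL
  have hpre := stackMap_pre_mem t c d hL
  have e : pre ++ post = pre ++ [] ++ post := by simp
  rw [hp, hn, h0, e, phi_append, phi_append, phi_append]
  have h := congrArg (fun y => stackMap t c d post y [])
    (stackMap_skein t c d hpre.1.1 hpre.2)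
  simpa [stackMap_nil] using h

theorem stackMap_twist {t : kˣ} {c d : Fin 2 → k} (s : Bool) {u : List Layer}
    (hu : u = kinkRight (crossing s) ∨ u = kinkLeft (crossing s)) {m n : ℕ}
    (hm : LengthComposable m (shift n u)) {z : States k} (hz : z ∈ rowStates k m) :
    stackMap t c d (shift n u) z = twist t s • z := by
  rcases hu with rfl | rfl
  · refine stackMap_shift_eq_smul (l := 1) ?_
      (forall_length_one (stackMap_kinkRight t c d s)) ?_ hz <;>
      cases s <;> simp [LengthComposable, shift, crossing, kinkRight, Piece.dom,
        Piece.cod] at hm ⊢ <;> omega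
  · refine stackMap_shift_eq_smul (l := 1) ?_
      (forall_length_one (stackMap_kinkLeft t c d s)) ?_ hz <;>
      cases s <;> simp [LengthComposable, shift, crossing, kinkLeft, Piece.dom,
        Piece.cod] at hm ⊢ <;> omega

theorem eq_single_of_mem_rowStates_zero {z : States k} (hz : z ∈ rowStates k 0) :
    z = Finsupp.single [] (z []) := by
  ext s
  by_cases h : s = []
  · simp [h]
  · rw [Finsupp.single_eq_of_ne h]
    by_contra hs
    have := (Finsupp.mem_supported k z).mp hz (Finsupp.mem_support_iff.mpr hs)
    exact h (List.length_eq_zero_iff.mp this)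

/-- The states of an empty row form a line, so an endomorphism of it is a scalar. -/
theorem IsClosedStack.stackMap_eq (t : kˣ) (c d : Fin 2 → k) {L : List Layer}
    (h : IsClosedStack L) :
    stackMap t c d L (Finsupp.single [] 1) = phi t c d L • Finsupp.single [] 1 := by
  have h1 := stackMap_mem t c d h.lengthComposable
    (single_mem_rowStates (k := k) (s := []) rfl 1)
  have h2 : rowLength 0 L = 0 := by
    have := h.1.lengthComposable.2
    rw [h.2] at this
    exact this.symm
  rw [h2] at h1
  rw [eq_single_of_mem_rowStates_zero h1, Finsupp.smul_single, smul_eq_mul, mul_one, phi]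

theorem IsClosedStack.stackMap_shift (t : kˣ) (c d : Fin 2 → k) {L : List Layer}
    (h : IsClosedStack L) {m n : ℕ} (hm : LengthComposable m (shift n L)) {z : States k}
    (hz : z ∈ rowStates k m) :
    stackMap t c d (shift n L) z = phi t c d L • z := by
  -- `LengthComposable` yields `n ≤ m` only through a first layer, so the empty stack is treated
  -- apart.
  cases L with
  | nil => simp [shift, phi, stackMap_nil]
  | cons x L =>
    refine stackMap_shift_eq_smul h.lengthComposable (fun s hs => ?_) ?_ hz
    · rw [List.length_eq_zero_iff.mp hs, h.stackMap_eq]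
    · have := hm.1
      simp only at this
      omega

/-- The quantum dimension of `V`: the trace of `K` for one orientation and of `K⁻¹` for the other,
which coincide. -/
theorem phi_circle (t : kˣ) (c d : Fin 2 → k) {L : List Layer}
    (hL : L = [(0, .capDU), (0, .cupDU)] ∨ L = [(0, .capUD), (0, .cupUD)]) :
    phi t c d L = (t : k) ^ 2 + ((t : k) ^ 2)⁻¹ := by
  rcases hL with rfl | rfl <;>
    simp [phi, stackMap_cons, stackMap_nil, layerMap_single_one,
      lmapDomain_single, Piece.dom, pieceMap_capDU, pieceMap_capUD, pieceMap_cupDU,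
      pieceMap_cupUD, add_comm,
      -Finsupp.lmapDomain_apply, -Finsupp.smul_single]

theorem isClosedStack_circle {L : List Layer}
    (hL : L = [(0, .capDU), (0, .cupDU)] ∨ L = [(0, .capUD), (0, .cupUD)]) : IsClosedStack L := by
  rcases hL with rfl | rfl <;>
    simp [IsClosedStack, Composable, Fits, below, target, Piece.dom, Piece.cod]

end Invariance

/-! ### Diagonal matrices moved along the strand, and the coframing identities. -/

section Coframing

variable {k : Type*} [Field k]

/-- The weight of a colouring of a row of strands under a diagonal matrix. -/
def weight (a : Fin 2 → kˣ) : List Dir → List (Fin 2) → kˣ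
  | .down :: w, i :: s => a i * weight a w s
  | .up :: w, i :: s => (a i)⁻¹ * weight a w s
  -- Besides lists of different lengths, this covers the empty row, whose weight must be `1`.
  | _, _ => 1

theorem weight_append (a : Fin 2 → kˣ) {w : List Dir} {s : List (Fin 2)} (w' : List Dir)
    (s' : List (Fin 2)) (h : s.length = w.length) :
    weight a (w ++ w') (s ++ s') = weight a w s * weight a w' s' := by
  induction w generalizing s with
  | nil =>
    rw [List.length_nil, List.length_eq_zero_iff] at h
    subst h
    simp [weight]
  | cons x w ih =>
    cases s with
    | nil => simp at h
    | cons i s =>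
      cases x <;> simp [weight, ih (Nat.succ.inj h), mul_assoc]

/-- Crossings, maxima and minima preserve weights; a diagonal matrix can be moved from the leg to
the head. -/
theorem entry_weight (t : kˣ) (c d : Fin 2 → k) (a : Fin 2 → kˣ) (g : Piece)
    {s u : List (Fin 2)} (hs : s.length = g.dom.length) (hu : u.length = g.cod.length) :
    entry t c (fun i => a i * d i) g s u * (weight a g.cod u : k) =
      (weight a g.dom s : k) * entry t (fun i => a i * c i) d g s u := by
  cases g <;> simp only [Piece.dom, Piece.cod, List.length_cons, List.length_nil, zero_add,
    Nat.reduceAdd, List.length_eq_zero_iff, List.length_eq_one_iff, List.length_eq_two] at hs hu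
  case pos | neg =>
    obtain ⟨i, j, rfl⟩ := hs
    obtain ⟨l, m, rfl⟩ := hu
    simp only [entry_pos, entry_neg, Piece.dom, Piece.cod, weight]
    -- An entry of a crossing vanishes unless the two colours below are those above, up to order;
    -- then the weights agree.
    fin_cases i <;> fin_cases j <;> fin_cases l <;> fin_cases m <;> simp <;> ring
  case capDU | capUD =>
    obtain ⟨l, m, rfl⟩ := hu
    subst hs
    simp only [entry_capDU, entry_capUD, Piece.dom, Piece.cod, weight]
    -- Only equal colours on the two ends contribute, with weight `a l * (a l)⁻¹ = 1`.
    fin_cases l <;> fin_cases m <;> simp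
  case cupDU | cupUD =>
    obtain ⟨l, m, rfl⟩ := hs
    subst hu
    simp only [entry_cupDU, entry_cupUD, Piece.dom, Piece.cod, weight]
    fin_cases l <;> fin_cases m <;> simp
  case leg =>
    obtain ⟨l, rfl⟩ := hu
    subst hs
    simp [entry_leg, weight, Piece.dom, Piece.cod, mul_comm]
  case head =>
    obtain ⟨l, rfl⟩ := hs
    subst hu
    simp [entry_head, weight, Piece.dom, Piece.cod]

/-- The action of a diagonal matrix on the tensor product attached to a row of strands. -/
def gauge (a : Fin 2 → kˣ) (w : List Dir) : States k →ₗ[k] States k :=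
  Finsupp.linearCombination k fun s => Finsupp.single s (weight a w s : k)

theorem gauge_single (a : Fin 2 → kˣ) (w : List Dir) (s : List (Fin 2)) (b : k) :
    gauge a w (Finsupp.single s b) = Finsupp.single s (b * weight a w s) := by
  rw [gauge, Finsupp.linearCombination_single, Finsupp.smul_single, smul_eq_mul]

theorem gauge_layerMap (t : kˣ) (c d : Fin 2 → k) (a : Fin 2 → kˣ) {w : List Dir} {x : Layer}
    (hx : Fits w x) {z : States k} (hz : z ∈ rowStates k w.length) :
    gauge a (below w x) (layerMap t c (fun i => a i * d i) x z) =
      layerMap t (fun i => a i * c i) d x (gauge a w z) := by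
  have key : ∀ s : List (Fin 2), s.length = w.length →
      (gauge a (below w x) ∘ₗ layerMap t c (fun i => a i * d i) x) (Finsupp.single s 1) =
        (layerMap t (fun i => a i * c i) d x ∘ₗ gauge a w) (Finsupp.single s 1) := by
    intro s hs
    obtain ⟨v, hv⟩ := hx.2
    have hle := hx.length_le
    have hw : w = w.take x.1 ++ x.2.dom ++ v := by
      rw [List.append_assoc, hv, List.take_append_drop]
    have hv' : w.drop (x.1 + x.2.dom.length) = v := by
      rw [← List.drop_drop, ← hv, List.drop_left]
    obtain ⟨p, s, q, rfl, hp, hs', hq⟩ := exists_split s hs hle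
    have hpw : p.length = (w.take x.1).length := by
      rw [hp, List.length_take]
      omega
    simp only [LinearMap.comp_apply, gauge_single, one_mul]
    rw [layerMap_single t _ _ x.1 x.2 hp hs', layerMap_single t _ _ x.1 x.2 hp hs', one_smul,
      map_sum, Finset.smul_sum]
    refine Finset.sum_congr rfl fun u _ => ?_
    have hu : (List.ofFn u).length = x.2.cod.length := by simp
    rw [gauge_single, Finsupp.smul_single, smul_eq_mul, below, hv']
    congr 1
    conv_rhs => rw [hw]
    rw [weight_append a _ _ (by simp [hpw]), weight_append a _ _ hpw,
      weight_append a _ _ (by simp only [List.length_append, hpw, hs']),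
      weight_append a _ _ hpw]
    have h := entry_weight t c d a x.2 hs' hu
    push_cast
    -- The strands beside the piece contribute a common factor to both sides.
    linear_combination (weight a (w.take x.1) p : k) * (weight a v q : k) * h
  exact eqOn_rowStates key hz

theorem gauge_stackMap (t : kˣ) (c d : Fin 2 → k) (a : Fin 2 → kˣ) {w : List Dir}
    {L : List Layer} (hL : Composable w L) {z : States k} (hz : z ∈ rowStates k w.length) :
    gauge a (target w L) (stackMap t c (fun i => a i * d i) L z) =
      stackMap t (fun i => a i * c i) d L (gauge a w z) := by
  induction L generalizing w z with
  | nil => rfl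
  | cons x L ih =>
    rw [stackMap_cons, stackMap_cons, LinearMap.comp_apply, LinearMap.comp_apply,
      ← gauge_layerMap t c d a hL.1 hz]
    refine ih hL.2 ?_
    rw [length_below hL.1]
    exact layerMap_mem t c _ hL.1.length_le hz

/-- A diagonal matrix can be moved from the leg to the head. -/
theorem phi_gauge (t : kˣ) (c d : Fin 2 → k) (a : Fin 2 → kˣ) {L : List Layer}
    (hL : IsClosedStack L) :
    phi t (fun i => a i * c i) d L = phi t c (fun i => a i * d i) L := by
  have h := gauge_stackMap t c d a hL.1 (single_mem_rowStates (k := k) (s := []) rfl 1)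
  -- A closed stack starts and ends in the empty row, where the diagonal matrix acts trivially; only
  -- the change of coefficients at the end-points remains.
  rw [hL.2, hL.stackMap_eq, gauge_single, map_smul, gauge_single] at h
  simp only [weight, Units.val_one, mul_one] at h
  rw [hL.stackMap_eq] at h
  simpa using (DFunLike.congr_fun h []).symm

/-- The diagonal matrix of a full turn. -/
def turn (t : kˣ) (s : Bool) : Fin 2 → kˣ :=
  if s then ![t ^ 2, (t ^ 2)⁻¹] else ![(t ^ 2)⁻¹, t ^ 2]

theorem layerMap_congr_leg (t : kˣ) (c c' d : Fin 2 → k) {x : Layer} (hx : x.2 ≠ .leg) :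
    layerMap t c d x = layerMap t c' d x := by
  have h : entry t c d x.2 = entry t c' d x.2 := by
    funext s u
    generalize x.2 = g at hx
    unfold entry
    cases g <;> first | exact absurd rfl hx | (split <;> first | rfl | simp_all)
  have h' : pieceMap t c d x.2 = pieceMap t c' d x.2 := by
    funext s
    simp only [pieceMap, h]
  simp only [layerMap, h']

theorem layerMap_congr_head (t : kˣ) (c d d' : Fin 2 → k) {x : Layer} (hx : x.2 ≠ .head) :
    layerMap t c d x = layerMap t c d' x := by
  have h : entry t c d x.2 = entry t c d' x.2 := by
    funext s u
    generalize x.2 = g at hx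
    unfold entry
    cases g <;> first | exact absurd rfl hx | (split <;> first | rfl | simp_all)
  have h' : pieceMap t c d x.2 = pieceMap t c d' x.2 := by
    funext s
    simp only [pieceMap, h]
  simp only [layerMap, h']

/-- In the counterclockwise loop the only weight is the `K` of `.cupDU`, in the clockwise loop it is
the `K⁻¹` of `.capUD`. The loop thus applies this matrix to the vector at the leg. -/
theorem stackMap_legLoop (t : kˣ) (c d : Fin 2 → k) (s : Bool) {m n : ℕ} (hm : n ≤ m)
    {z : States k} (hz : z ∈ rowStates k m) :
    stackMap t c d (legLoop s n) z = layerMap t (fun i => turn t s i * c i) d (n, .leg) z := by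
  have h1 : legLoop s n = shift n (legLoop s 0) := by cases s <;> simp [legLoop, shift]
  have h2 : layerMap t (fun i => turn t s i * c i) d (n, .leg) =
      stackMap t (fun i => turn t s i * c i) d (shift n [(0, .leg)]) := by
    simp [shift, stackMap_cons, stackMap_nil]
  rw [h1, h2]
  refine stackMap_shift_congr (l := 0) ?_ ?_ (fun w hw => ?_) hm hz
  · cases s <;> simp [legLoop, LengthComposable, Piece.dom, Piece.cod]
  · simp [LengthComposable, Piece.dom]
  · rw [List.length_eq_zero_iff.mp hw]
    cases s <;>
      simp [legLoop, turn, stackMap_cons, stackMap_nil, layerMap_single_one, lmapDomain_single,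
        Piece.dom, pieceMap_capDU, pieceMap_capUD, pieceMap_cupDU, pieceMap_cupUD, pieceMap_leg,
        smul_smul, mul_comm, -Finsupp.lmapDomain_apply, -Finsupp.smul_single]

/-- The same two weights occur as at the leg, so loops that turn alike give the same diagonal
matrix. -/
theorem stackMap_headLoop (t : kˣ) (c d : Fin 2 → k) (s : Bool) {m n : ℕ} (hm : n + 1 ≤ m)
    {z : States k} (hz : z ∈ rowStates k m) :
    stackMap t c d (headLoop s n) z = layerMap t c (fun i => turn t s i * d i) (n, .head) z := by
  have h1 : headLoop s n = shift n (headLoop s 0) := by cases s <;> simp [headLoop, shift]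
  have h2 : layerMap t c (fun i => turn t s i * d i) (n, .head) =
      stackMap t c (fun i => turn t s i * d i) (shift n [(0, .head)]) := by
    simp [shift, stackMap_cons, stackMap_nil]
  rw [h1, h2]
  refine stackMap_shift_congr (l := 1) ?_ ?_ (forall_length_one fun b => ?_) hm hz
  · cases s <;> simp [headLoop, LengthComposable, Piece.dom, Piece.cod]
  · simp [LengthComposable, Piece.dom]
  · cases s <;> fin_cases b <;>
      simp [headLoop, turn, stackMap_cons, stackMap_nil, layerMap_single_one, lmapDomain_single,
        Piece.dom, pieceMap_capDU, pieceMap_capUD, pieceMap_cupDU, pieceMap_cupUD, pieceMap_head,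
        smul_smul, mul_comm, -Finsupp.lmapDomain_apply, -Finsupp.smul_single]

theorem stackMap_addLegLoop (t : kˣ) (c d : Fin 2 → k) (s : Bool) {m : ℕ} {L : List Layer}
    (hL : LengthComposable m L) {z : States k} (hz : z ∈ rowStates k m) :
    stackMap t c d (addLegLoop s L) z = stackMap t (fun i => turn t s i * c i) d L z := by
  induction L generalizing m z with
  | nil => rfl
  | cons x L ih =>
    have h : addLegLoop s (x :: L) =
        (if x.2 = .leg then legLoop s x.1 else [x]) ++ addLegLoop s L := rfl
    have hx : stackMap t c d (if x.2 = .leg then legLoop s x.1 else [x]) z =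
        layerMap t (fun i => turn t s i * c i) d x z := by
      split_ifs with hg
      · rw [stackMap_legLoop t c d s (Nat.le_of_add_right_le hL.1) hz, ← hg]
      · rw [stackMap_cons, layerMap_congr_leg t c (fun i => turn t s i * c i) d hg]
        rfl
    rw [h, stackMap_append, stackMap_cons, LinearMap.comp_apply, LinearMap.comp_apply, hx,
      ih hL.2 (layerMap_mem t _ d hL.1 hz)]

theorem stackMap_addHeadLoop (t : kˣ) (c d : Fin 2 → k) (s : Bool) {m : ℕ} {L : List Layer}
    (hL : LengthComposable m L) {z : States k} (hz : z ∈ rowStates k m) :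
    stackMap t c d (addHeadLoop s L) z = stackMap t c (fun i => turn t s i * d i) L z := by
  induction L generalizing m z with
  | nil => rfl
  | cons x L ih =>
    have h : addHeadLoop s (x :: L) =
        (if x.2 = .head then headLoop s x.1 else [x]) ++ addHeadLoop s L := rfl
    have hx : stackMap t c d (if x.2 = .head then headLoop s x.1 else [x]) z =
        layerMap t c (fun i => turn t s i * d i) x z := by
      split_ifs with hg
      · have hm := hL.1
        rw [hg] at hm
        rw [stackMap_headLoop t c d s hm hz, ← hg]
      · rw [stackMap_cons, layerMap_congr_head t c d (fun i => turn t s i * d i) hg]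
        rfl
    rw [h, stackMap_append, stackMap_cons, LinearMap.comp_apply, LinearMap.comp_apply, hx,
      ih hL.2 (layerMap_mem t c _ hL.1 hz)]

theorem phi_addLegLoop (t : kˣ) (c d : Fin 2 → k) (s : Bool) {L : List Layer}
    (hL : IsClosedStack L) :
    phi t c d (addLegLoop s L) = phi t (fun i => turn t s i * c i) d L := by
  rw [phi, phi, stackMap_addLegLoop t c d s hL.lengthComposable (single_mem_rowStates rfl 1)]

theorem phi_addHeadLoop (t : kˣ) (c d : Fin 2 → k) (s : Bool) {L : List Layer}
    (hL : IsClosedStack L) :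
    phi t c d (addHeadLoop s L) = phi t c (fun i => turn t s i * d i) L := by
  rw [phi, phi, stackMap_addHeadLoop t c d s hL.lengthComposable (single_mem_rowStates rfl 1)]

/-- The assignment is invariant under the moves. -/
theorem Move.phi_eq (t : kˣ) (c : Fin 2 → k) {D D' : MultiDiagram} (h : Move D D') :
    phi t c c D.layers = phi t c c D'.layers := by
  cases h with
  | loc pre post n u v h hD hD' => exact phi_eq_of_localMove t c c h hD hD'
  | coframing s D₀ hD hD' =>
    -- Both loops become the matrix `turn t s`, once on the leg coefficients and once on the head
    -- coefficients; `phi_gauge` carries it from one to the other.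
    rw [hD, hD', phi_addLegLoop t c c s D₀.isClosed, phi_addHeadLoop t c c s D₀.isClosed,
      phi_gauge t c c _ D₀.isClosed]

/-- The invariant of biframed planar multi-knotoids defined by `φ` with `d = c`. -/
def invariant (t : kˣ) (c : Fin 2 → k) : BiframedPlanarMultiknotoid → k :=
  Quot.lift (fun D => phi t c c D.layers) fun _ _ h => h.phi_eq t c

theorem invariant_toClass (t : kˣ) (c : Fin 2 → k) (D : MultiDiagram) :
    invariant t c D.toClass = phi t c c D.layers := rfl

theorem turn_true_mul (t : kˣ) (c : Fin 2 → k) :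
    (fun i => (turn t true i : k) * c i) =
      ![(t : k) ^ 2 * c 0, ((t : k) ^ 2)⁻¹ * c 1] := by
  ext i
  fin_cases i <;> simp [turn]

theorem turn_false_mul (t : kˣ) (c : Fin 2 → k) :
    (fun i => (turn t false i : k) * c i) =
      ![((t : k) ^ 2)⁻¹ * c 0, (t : k) ^ 2 * c 1] := by
  ext i
  fin_cases i <;> simp [turn]

theorem phi_trivialDiagram (t : kˣ) (c d : Fin 2 → k) :
    phi t c d trivialDiagram.layers = c 0 * d 0 + c 1 * d 1 := by
  simp [trivialDiagram, phi, stackMap_cons, stackMap_nil, layerMap_single_one, lmapDomain_single,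
    Piece.dom, pieceMap_leg, pieceMap_head, -Finsupp.lmapDomain_apply, -Finsupp.smul_single]

end Coframing

end BiframedKnotoid

end

/-! ### The normalized invariant and its properties. -/

open BiframedKnotoid in
theorem proposition3p11 {k : Type*} [Field k] (t : kˣ) (ht : (t : k) ^ 4 ≠ 1)
    (r : k) (hr : r ^ 2 = 2) (h2 : (2 : k) ≠ 0)
    (c : Fin 2 → k) (hc : c = fun _ => 1 / r) :
    -- the crossings, maxima and minima are sent to morphisms of `U_q(sl_2)`-modules
    (IsIntertwiner (tensorRep t (rep t) (rep t)) (tensorRep t (rep t) (rep t))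
        (braiding t).toLinearMap ∧
      IsIntertwiner (tensorRep t (rep t) (rep t)) (tensorRep t (rep t) (rep t))
        (braiding t).symm.toLinearMap ∧
      IsIntertwiner (tensorRep t (dualRep t) (rep t)) (trivialRep t) (ev k) ∧
      IsIntertwiner (trivialRep t) (tensorRep t (rep t) (dualRep t)) (coev k) ∧
      IsIntertwiner (tensorRep t (rep t) (dualRep t)) (trivialRep t) (evBar t) ∧
      IsIntertwiner (trivialRep t) (tensorRep t (dualRep t) (rep t)) (coevBar t)) ∧
    ∃ (Qm : BiframedPlanarMultiknotoid → k) (Q : BiframedPlanarKnotoid → k),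
      (∀ K, Q K = Qm K.toMulti) ∧
      -- the invariant is computed by `φ` with `c_i = d_i = 1 / √2`
      (∀ D : MultiDiagram, Qm D.toClass = phi t c c D.layers) ∧
      -- the skein relation
      (∀ (Dp Dn D₀ : MultiDiagram) (pre post : List Layer) (n : ℕ),
        Dp.layers = pre ++ [(n, .pos)] ++ post → Dn.layers = pre ++ [(n, .neg)] ++ post →
        D₀.layers = pre ++ post →
        (t : k) * Qm Dp.toClass - (t : k)⁻¹ * Qm Dn.toClass =
          ((t : k) ^ 2 - ((t : k) ^ 2)⁻¹) * Qm D₀.toClass) ∧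
      -- a curl multiplies the value by `q^{3/4}` or `q^{-3/4}`, according to its sign
      (∀ (D D₀ : MultiDiagram) (pre post : List Layer) (n : ℕ),
        (D.layers = pre ++ shift n (kinkRight .pos) ++ post ∨
          D.layers = pre ++ shift n (kinkLeft .pos) ++ post) →
        D₀.layers = pre ++ post → Qm D.toClass = (t : k) ^ 3 * Qm D₀.toClass) ∧
      (∀ (D D₀ : MultiDiagram) (pre post : List Layer) (n : ℕ),
        (D.layers = pre ++ shift n (kinkRight .neg) ++ post ∨
          D.layers = pre ++ shift n (kinkLeft .neg) ++ post) →
        D₀.layers = pre ++ post → Qm D.toClass = ((t : k) ^ 3)⁻¹ * Qm D₀.toClass) ∧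
      -- a separate link multiplies the value by its own value under `φ`
      (∀ (D D₀ : MultiDiagram) (pre post L : List Layer) (n : ℕ), IsLink L →
        D.layers = pre ++ shift n L ++ post → D₀.layers = pre ++ post →
        Qm D.toClass = phi t c c L * Qm D₀.toClass) ∧
      -- a separate circle multiplies the value by `q^{1/2} + q^{-1/2}`
      (∀ (D D₀ : MultiDiagram) (pre post : List Layer) (n : ℕ),
        (D.layers = pre ++ shift n [(0, .capDU), (0, .cupDU)] ++ post ∨
          D.layers = pre ++ shift n [(0, .capUD), (0, .cupUD)] ++ post) →
        D₀.layers = pre ++ post →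
        Qm D.toClass = ((t : k) ^ 2 + ((t : k) ^ 2)⁻¹) * Qm D₀.toClass) ∧
      -- a coframing loop at an end-point acts by `K` or `K⁻¹` on the coefficients there
      (∀ (D D₀ : MultiDiagram),
        (D.layers = addLegLoop true D₀.layers →
          Qm D.toClass = phi t ![(t : k) ^ 2 * c 0, ((t : k) ^ 2)⁻¹ * c 1] c D₀.layers) ∧
        (D.layers = addLegLoop false D₀.layers →
          Qm D.toClass = phi t ![((t : k) ^ 2)⁻¹ * c 0, (t : k) ^ 2 * c 1] c D₀.layers) ∧
        (D.layers = addHeadLoop true D₀.layers →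
          Qm D.toClass = phi t c ![(t : k) ^ 2 * c 0, ((t : k) ^ 2)⁻¹ * c 1] D₀.layers) ∧
        (D.layers = addHeadLoop false D₀.layers →
          Qm D.toClass = phi t c ![((t : k) ^ 2)⁻¹ * c 0, (t : k) ^ 2 * c 1] D₀.layers)) ∧
      Q trivialKnotoid = 1 := by
  have hr0 : r ≠ 0 := by
    rintro rfl
    exact h2 (by rw [← hr]; ring)
  refine ⟨⟨braiding_isIntertwiner t, (braiding_isIntertwiner t).symm, ev_isIntertwiner t,
      coev_isIntertwiner t, evBar_isIntertwiner t, coevBar_isIntertwiner t⟩,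
    invariant t c, fun K => invariant t c K.toMulti,
    fun _ => rfl, invariant_toClass t c,
    fun Dp Dn D₀ pre post n hp hn h0 => phi_skein t _ _ hp hn h0,
    fun D D₀ pre post n h h0 => ?_, fun D D₀ pre post n h h0 => ?_,
    fun D D₀ pre post L n hL h h0 => ?_, fun D D₀ pre post n h h0 => ?_,
    fun D D₀ => ⟨fun h => ?_, fun h => ?_, fun h => ?_, fun h => ?_⟩, ?_⟩
  · rcases h with h | h
    · exact phi_eq_smul t _ _ h h0 fun m hm z hz => stackMap_twist true (.inl rfl) hm hz
    · exact phi_eq_smul t _ _ h h0 fun m hm z hz => stackMap_twist true (.inr rfl) hm hz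
  · rcases h with h | h
    · exact phi_eq_smul t _ _ h h0 fun m hm z hz => stackMap_twist false (.inl rfl) hm hz
    · exact phi_eq_smul t _ _ h h0 fun m hm z hz => stackMap_twist false (.inr rfl) hm hz
  · exact phi_eq_smul t _ _ h h0 fun m hm z hz => hL.1.stackMap_shift t _ _ hm hz
  · obtain ⟨L, hL, h⟩ : ∃ L, (L = [(0, .capDU), (0, .cupDU)] ∨ L = [(0, .capUD), (0, .cupUD)]) ∧
        D.layers = pre ++ shift n L ++ post :=
      h.elim (fun h => ⟨_, .inl rfl, h⟩) fun h => ⟨_, .inr rfl, h⟩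
    rw [← phi_circle t c c hL]
    exact phi_eq_smul t _ _ h h0 fun m hm z hz =>
      (isClosedStack_circle hL).stackMap_shift t _ _ hm hz
  · rw [invariant_toClass, h, phi_addLegLoop t c c true D₀.isClosed, turn_true_mul]
  · rw [invariant_toClass, h, phi_addLegLoop t c c false D₀.isClosed, turn_false_mul]
  · rw [invariant_toClass, h, phi_addHeadLoop t c c true D₀.isClosed, turn_true_mul]
  · rw [invariant_toClass, h, phi_addHeadLoop t c c false D₀.isClosed, turn_false_mul]
  · subst hc
    -- The arc has the value `c 0 * d 0 + c 1 * d 1`, here `2 / r ^ 2`.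
    refine (phi_trivialDiagram t _ _).trans ?_
    field_simp
    rw [hr]
    norm_num
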